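/- Let $\mathfrak g$ be a finite-dimensional simple real Lie algebra with the metric $\langle x,y\rangle=\mathrm{tr}_R(xy)$ of a finite-dimensional representation $R$, assumed nondegenerate. Let $t^-,t^0,t^+$ span an $s\ell(2,\mathbb R)$ subalgebra, with $[t^0,t^\pm]=\pm t^\pm$ and $[t^+,t^-]=2t^0$, whose grading $\mathfrak g=\mathfrak g_-\oplus\mathfrak g_0\oplus\mathfrak g_+$ by the eigenvalues of $\mathrm{ad}\,t^0$ is integral, and assume that $\mathfrak g_+$ (equivalently the group $G_+=\exp\mathfrak g_+$) is Abelian. Let $t^a$ be a homogeneous basis of $\mathfrak g$, and let $J_a$ be the coordinates of the generic element $J_{tot}=J_at^a$, with Poisson bracket $\{J_a,J_b\}=f_{ab}{}^cJ_c$, where $f_{ab}{}^c$ are the structure constants with indices moved by $\eta^{ab}=\langle t^a,t^b\rangle$. Indices $\alpha$ refer to negative degree. *The finite W-algebra of $G_+$.* It is the algebra $\mathcal W$ of polynomials in the $J_a$ of degree $\ge 0$ that are invariant under the gauge transformations $J\mapsto g^{-1}Jg$, $g\in G_+$, of the constraint surface $J_\alpha t^\alpha=t^-$; its bracket is the Poisson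 bracket followed by restriction to that surface. Fix a basis $\ell^s$ of $\ker\mathrm{ad}\,t^+$ with $[t^0,\ell^s]=\sigma(s)\ell^s$. *The enlarged W-algebra.* Let $O\subset\mathfrak g_-$ be the set of $\psi(t^-)\in\mathfrak g_-$, where $\psi$ runs over the automorphisms of $\mathfrak g$ that fix $t^0$ and preserve the metric (it contains the orbit of $t^-$ under $G_0$). Let $V\subset O$ be open. For $\tilde t^-=J_\alpha t^\alpha\in V$ let $\tilde t^+$ complete $\tilde t^-,t^0$ to an $s\ell(2,\mathbb R)$ triple, and let $\tilde\ell^s$ be any basis of $\ker\mathrm{ad}\,\tilde t^+$ with $[t^0,\tilde\ell^s]=\sigma(s)\tilde\ell^s$ that depends smoothly on the $J_\alpha$. The enlarged W-algebra is generated by the $J_\alpha$ and by the $\tilde W_s$ defined by $g^{-1}J_{tot}\,g=J_\alpha t^\alpha+\tilde W_s\tilde\ell^s$ with $g\in G_+$. **Claim.** Over $V$ the element $g$ and the $\tilde W_s$ exist and are unique. $\mathcal W$ is closed under its bracket, and is generated by the polynomials $W_s$ defined by $g^{-1}Jg=t^-+W_s\ell^s$, $g\in G_+$, on the constraint surface.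 Moreover: 1. For every $c_0\in V$ there are an open set $U\subset V$ that contains $c_0$ and is dense in $V$, and smooth functions $F_{sr}$ on $U$ with $(F_{sr}(c))$ invertible for each $c\in U$ and $F_{sr}=0$ unless $\sigma(s)=\sigma(r)$, such that the renormalized generators $\hat W_s=\sum_rF_{sr}(J_\alpha)\tilde W_r$ form the finite W-algebra of $G_+$: they are smooth on $\{J_\alpha t^\alpha\in U\}$, they Poisson commute with all $J_\alpha$, and $W_s\mapsto\hat W_s$ extends to an injective homomorphism of Poisson algebras from $\mathcal W$ to the functions on $\{J_\alpha t^\alpha\in U\}$. 2. Suppose that $V\neq\emptyset$ and that the $\tilde\ell^s$ are proportional to conjugates of the $\ell^s$: there are nowhere zero smooth functions $m_s$ on $V$ such that for each $c\in V$ some automorphism $\psi$ of $\mathfrak g$ that fixes $t^0$ and preserves the metric satisfies $\psi(t^-)=c$ and $\psi(\ell^s)=m_s(c)\,\tilde\ell^s(c)$ for all $s$. Then the rescaled generators $\hat W_s=m_s(J_\alpha)^{-1}\,\tilde W_s$ form the finite W-algebra of $G_+$ over all of $V$, in the same sense. -/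

import Mathlib

open scoped ContDiff

noncomputable section

namespace FiniteW

variable {g : Type*} [LieRing g] [LieAlgebra ℝ g]
variable {ι : Type*} [Fintype ι] [DecidableEq ι]

/-- The metric `η^{ab} = ⟨t^a, t^b⟩` in the basis `t^a`. -/
def metric (B : LinearMap.BilinForm ℝ g) (t : Module.Basis ι ℝ g) : Matrix ι ι ℝ :=
  Matrix.of fun a d => B (t a) (t d)

/-- The lowered structure constants
`f_{ab}^c = η_{ad} η_{be} η^{ck} f^{de}_k`, where `[t^d, t^e] = f^{de}_k t^k` and
`η_{ab}` is the inverse matrix of `η^{ab}`. -/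
def lowStruct (B : LinearMap.BilinForm ℝ g) (t : Module.Basis ι ℝ g) (a b c : ι) : ℝ :=
  ∑ d, ∑ e, ∑ k, (metric B t)⁻¹ a d * (metric B t)⁻¹ b e * metric B t c k *
    t.repr ⁅t d, t e⁆ k

/-- The Poisson bracket on functions of the coordinates `J_a`, determined by
`{J_a, J_b} = f_{ab}^c J_c`.  A point `x : ι → ℝ` stands for the values of the `J_a`. -/
def poisson (B : LinearMap.BilinForm ℝ g) (t : Module.Basis ι ℝ g)
    (F H : (ι → ℝ) → ℝ) (x : ι → ℝ) : ℝ :=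
  ∑ a, ∑ b, fderiv ℝ F x (Pi.single a 1) * fderiv ℝ H x (Pi.single b 1) *
    ∑ c, lowStruct B t a b c * x c

/-- The same Poisson bracket on polynomials in the `J_a`. -/
def polyPoisson (B : LinearMap.BilinForm ℝ g) (t : Module.Basis ι ℝ g)
    (P Q : MvPolynomial ι ℝ) : MvPolynomial ι ℝ :=
  ∑ a, ∑ b, MvPolynomial.pderiv a P * MvPolynomial.pderiv b Q *
    ∑ c, MvPolynomial.C (lowStruct B t a b c) * MvPolynomial.X c

/-- The indices `α ∈ I_-` of negative degree. -/
abbrev NegIdx (deg : ι → ℤ) : Type _ := {a : ι // deg a < 0}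

/-- The indices of degree zero or positive degree. -/
abbrev NonnegIdx (deg : ι → ℤ) : Type _ := {a : ι // 0 ≤ deg a}

/-- The matrix `J_tot = J_a t^a` at the point `x`. -/
def total (t : Module.Basis ι ℝ g) (x : ι → ℝ) : g := ∑ a, x a • t a

/-- The values of the `J_α`, `α ∈ I_-`, at the point `x`. -/
def negCoord (deg : ι → ℤ) (x : ι → ℝ) : NegIdx deg → ℝ := fun α => x α

/-- The element `J_α t^α` of `g_-`. -/
def negElt (t : Module.Basis ι ℝ g) (deg : ι → ℤ) (c : NegIdx deg → ℝ) : g :=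
  ∑ α : NegIdx deg, c α • t α

/-- The positive part `g_+` of the gradation. -/
def gPlus (t : Module.Basis ι ℝ g) (deg : ι → ℤ) : Submodule ℝ g :=
  Submodule.span ℝ (t '' {a | 0 < deg a})

/-- The adjoint action `exp (ad y)` of the group element `exp y`, for `ad y` nilpotent. -/
def expAd (y x : g) : g :=
  ∑ n ∈ Finset.range (nilpotencyClass (LieAlgebra.ad ℝ g y)),
    (n.factorial : ℝ)⁻¹ • ((LieAlgebra.ad ℝ g y) ^ n) x

/-- `ℓ` is a basis of the highest weight vectors `ker (ad e)`, with
`[t⁰, ℓ^s] = σ(s) ℓ^s` where `t⁰ = h / 2`. -/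
structure IsHighestWeightBasis {κ : Type*} (h e : g) (σ : κ → ℤ) (ℓ : κ → g) : Prop where
  linearIndependent : LinearIndependent ℝ ℓ
  span_eq : Submodule.span ℝ (Set.range ℓ) = LinearMap.ker (LieAlgebra.ad ℝ g e : g →ₗ[ℝ] g)
  weight : ∀ s, ⁅h, ℓ s⁆ = (2 * (σ s : ℝ)) • ℓ s

/-! ### The constrained algebra -/

/-- The point of the constraint surface `J_α = χ_α` with given values of the remaining `J_a`;
the `χ_α` are the coordinates of `f = t^-`. -/
def constrPt (t : Module.Basis ι ℝ g) (deg : ι → ℤ) (f : g) (u : NonnegIdx deg → ℝ) : ι → ℝ :=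
  fun a => if ha : 0 ≤ deg a then u ⟨a, ha⟩ else t.repr f a

/-- Imposing the constraints `J_α = χ_α` on a polynomial in the `J_a`. -/
def imposeConstr (t : Module.Basis ι ℝ g) (deg : ι → ℤ) (f : g) :
    MvPolynomial ι ℝ →ₐ[ℝ] MvPolynomial (NonnegIdx deg) ℝ :=
  MvPolynomial.aeval fun a =>
    if ha : 0 ≤ deg a then MvPolynomial.X ⟨a, ha⟩ else MvPolynomial.C (t.repr f a)

/-- The bracket `{p, q}_Const`: the constraints are imposed after the bracket is computed. -/
def constrBracket (B : LinearMap.BilinForm ℝ g) (t : Module.Basis ι ℝ g) (deg : ι → ℤ) (f : g)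
    (p q : MvPolynomial (NonnegIdx deg) ℝ) : MvPolynomial (NonnegIdx deg) ℝ :=
  imposeConstr t deg f
    (polyPoisson B t (MvPolynomial.rename Subtype.val p) (MvPolynomial.rename Subtype.val q))

/-- The finite W-algebra of the gauge group `G_+`: the polynomials in the `J_i` and `J_ᾱ` that
are invariant under the gauge transformations of the constraint surface (its Poisson bracket is
`constrBracket`). -/
def wAlgebra (t : Module.Basis ι ℝ g) (deg : ι → ℤ) (f : g) :
    Subalgebra ℝ (MvPolynomial (NonnegIdx deg) ℝ) where
  carrier := {p | ∀ y ∈ gPlus t deg, ∀ u u' : NonnegIdx deg → ℝ,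
    total t (constrPt t deg f u') = expAd y (total t (constrPt t deg f u)) →
      MvPolynomial.eval u' p = MvPolynomial.eval u p}
  mul_mem' := by
    intro p q hp hq y hy u u' h
    simp only [map_mul, hp y hy u u' h, hq y hy u u' h]
  add_mem' := by
    intro p q hp hq y hy u u' h
    simp only [map_add, hp y hy u u' h, hq y hy u u' h]
  algebraMap_mem' := by
    intro r y hy u u' h
    simp [MvPolynomial.algebraMap_eq]

/-- `W` are the generators of the finite W-algebra read off from the highest weight gauge
`J^g = t^- + W_s ℓ^s` with `g ∈ G_+`. -/
def IsGaugeGenerators {κ : Type*} [Fintype κ] (t : Module.Basis ι ℝ g) (deg : ι → ℤ) (f : g)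
    (ℓ : κ → g) (W : κ → wAlgebra t deg f) : Prop :=
  ∀ u : NonnegIdx deg → ℝ, ∃ y ∈ gPlus t deg,
    expAd y (total t (constrPt t deg f u)) =
      f + ∑ s, MvPolynomial.eval u (W s : MvPolynomial (NonnegIdx deg) ℝ) • ℓ s

/-! ### The enlarged algebra -/

/-- The element `exp y ∈ G_+` brings `J_tot` at the point `x` to the highest weight form
`J_α t^α + w_s ℓ^s`; the vectors `ℓ^s` depend on the `J_α`. -/
def IsHighestWeightForm {κ : Type*} [Fintype κ] (t : Module.Basis ι ℝ g) (deg : ι → ℤ)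
    (ℓ : κ → (NegIdx deg → ℝ) → g) (x : ι → ℝ) (y : g) (w : κ → ℝ) : Prop :=
  expAd y (total t x) = negElt t deg (negCoord deg x) + ∑ s, w s • ℓ s (negCoord deg x)

open scoped Classical in
/-- The generators `W̃_s` of the enlarged W-algebra (zero where the highest weight form cannot
be reached). -/
def wTilde {κ : Type*} [Fintype κ] (t : Module.Basis ι ℝ g) (deg : ι → ℤ)
    (ℓ : κ → (NegIdx deg → ℝ) → g) (s : κ) (x : ι → ℝ) : ℝ :=
  if hx : ∃ w : κ → ℝ, ∃ y ∈ gPlus t deg, IsHighestWeightForm t deg ℓ x y w then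
    hx.choose s else 0

/-- `ψ` is an automorphism of `g` which fixes `t⁰ = h / 2`, preserves the metric, and sends
`t^- = f` to `J_α t^α` with `J_α = c_α`.  The elements of `G_0` which send `t^-` to `J_α t^α`
act in this way. -/
structure IsGradedConj (B : LinearMap.BilinForm ℝ g) (t : Module.Basis ι ℝ g) (deg : ι → ℤ)
    (h f : g) (c : NegIdx deg → ℝ) (ψ : g ≃ₗ⁅ℝ⁆ g) : Prop where
  map_h : ψ h = h
  map_form : ∀ x y, B (ψ x) (ψ y) = B x y
  map_f : ψ f = negElt t deg c

/-- The values of the `J_α` for which `t̃^- = J_α t^α` is conjugate to `t^- = f`; this contains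
the orbit of `t^-` under the group `G_0`. -/
def regularSet (B : LinearMap.BilinForm ℝ g) (t : Module.Basis ι ℝ g) (deg : ι → ℤ) (h f : g) :
    Set (NegIdx deg → ℝ) :=
  {c | ∃ ψ : g ≃ₗ⁅ℝ⁆ g, IsGradedConj B t deg h f c ψ}

/-- `ℓ` is a smooth choice, over the open set `V` of values of the `J_α`, of a basis of the
highest weight vectors of the triple `t̃^+, t⁰, t̃^-` with `t̃^- = J_α t^α`. -/
structure IsHighestWeightFrame {κ : Type*} (t : Module.Basis ι ℝ g) (deg : ι → ℤ)
    (h : g) (σ : κ → ℤ) (V : Set (NegIdx deg → ℝ)) (ℓ : κ → (NegIdx deg → ℝ) → g) : Prop where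
  smooth : ∀ s, ContDiffOn ℝ ∞ (fun c => t.equivFun (ℓ s c)) V
  basis : ∀ c ∈ V, ∃ e' : g, IsSl2Triple h e' (negElt t deg c) ∧
    IsHighestWeightBasis h e' σ (fun s => ℓ s c)

/-- The renormalized generators `Ŵ_s = ∑_r F_{sr}(J_α) W̃_r`. -/
def renormalized {κ : Type*} [Fintype κ] (t : Module.Basis ι ℝ g) (deg : ι → ℤ)
    (ℓ : κ → (NegIdx deg → ℝ) → g) (F : (NegIdx deg → ℝ) → Matrix κ κ ℝ) (s : κ)
    (x : ι → ℝ) : ℝ :=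
  ∑ r, F (negCoord deg x) s r * wTilde t deg ℓ r x

/-- Over the set `U` of values of the `J_α`, the functions `What s` form the finite W-algebra of
`G_+` with generators `W s`: they are smooth, they Poisson commute with the `J_α`, and
`W s ↦ What s` extends to an injective homomorphism of Poisson algebras. -/
structure FormWAlgebra {κ : Type*} (B : LinearMap.BilinForm ℝ g) (t : Module.Basis ι ℝ g)
    (deg : ι → ℤ) (f : g) (U : Set (NegIdx deg → ℝ)) (W : κ → wAlgebra t deg f)
    (What : κ → (ι → ℝ) → ℝ) : Prop where
  smooth : ∀ s, ContDiffOn ℝ ∞ (What s) {x | negCoord deg x ∈ U}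
  central : ∀ (α : NegIdx deg) (s : κ) (x : ι → ℝ), negCoord deg x ∈ U →
    poisson B t (fun z => z α) (What s) x = 0
  exists_hom : ∃ Φ : wAlgebra t deg f →ₐ[ℝ] ((ι → ℝ) → ℝ),
    (∀ s, Φ (W s) = What s) ∧
    (∀ p, (∀ x, negCoord deg x ∈ U → Φ p x = 0) → p = 0) ∧
    ∀ p q r : wAlgebra t deg f,
      (r : MvPolynomial (NonnegIdx deg) ℝ) = constrBracket B t deg f p q →
        ∀ x, negCoord deg x ∈ U → poisson B t (Φ p) (Φ q) x = Φ r x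

end FiniteW

end

/-! Since `g_+` is Abelian the grading is short, `g = g_{-1} ⊕ g_0 ⊕ g_1`. Indeed, for `x` of degree
`k ≥ 2` both `⁅e, x⁆` and `⁅e, ⁅f, x⁆⁆` vanish, so `⁅h, x⁆ = 2k x` does too; nondegeneracy of the
metric then removes the degrees `≤ -2`. Hence `exp (ad y)` is quadratic in `y ∈ g_1`, it fixes the
component of degree `-1`, and it shifts the degree zero component of `X` by `⁅y, X_{-1}⁆`. If
`X_{-1} = f`, the relation `⁅e, ⁅y, f⁆⁆ = -2 y` shows that `y = ½ ⁅e, X_0⁆` is the only parameter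
leading to the highest weight gauge (`lie_expAd_sub_eq_zero_iff`). It is polynomial in `X`, so the
`W_s` are polynomials, and evaluating an invariant polynomial in this gauge expresses it through
them.

For the enlarged algebra, an automorphism `ψ` with `ψ f = c` identifies the constraint surface with
the fibre `J_- = c`, compatibly with the gauge action. Expanding `ψ⁻¹ ℓ̃^r` in the `ℓ^s` gives the
matrix `F(c)`, and `Ŵ_s(x) = W_s(ψ⁻¹ x)` (`eval_gen_eq_sum`). The map `Φ p (x) = p(ψ⁻¹ x)` is the
required homomorphism.

That `Φ` respects brackets although `ψ` changes with the fibre is the content of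
`poisson_eq_of_conj`. Agreement on one fibre determines a gradient up to `g_1`; gauge invariance
says that `g_1` pairs to zero with `⁅·, ∇H⁆` at `J`; and `g_1` is Abelian, so the ambiguity drops
out. The gradient of `J_α` itself lies in `g_1`, which gives centrality.

Only `F` has to be smooth, not `ψ`. Near each point a smooth `ψ` comes from the inverse function
theorem applied to `exp (ad g_0)` (`exists_smooth_gradedConj`), and the local choices are patched on
a dense open set. In the proportional case `F` is the diagonal matrix of the `m_s⁻¹`, already smooth
on all of `V`. -/

namespace FiniteW

/-! ### Gradings by `ad h`, shortness, and the quadratic action of `G_+`. -/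

section Grading

variable {g : Type*} [LieRing g] [LieAlgebra ℝ g]
variable {ι : Type*}

/-- The eigenspace of `ad h` for the eigenvalue `2 k`, that is, the vectors of degree `k`. -/
def gr (h : g) (k : ℤ) : Submodule ℝ g where
  carrier := {x | ⁅h, x⁆ = (2 * (k : ℝ)) • x}
  add_mem' := by
    intro a b ha hb
    simp only [Set.mem_ofPred_eq] at *
    rw [lie_add, ha, hb, smul_add]
  zero_mem' := by simp
  smul_mem' := by
    intro c x hx
    simp only [Set.mem_ofPred_eq] at *
    rw [lie_smul, hx, smul_comm]

lemma mem_gr {h : g} {k : ℤ} {x : g} : x ∈ gr h k ↔ ⁅h, x⁆ = (2 * (k : ℝ)) • x := Iff.rfl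

lemma lie_mem_gr {h x y : g} {i j k : ℤ} (hx : x ∈ gr h i) (hy : y ∈ gr h j)
    (hk : i + j = k) : ⁅x, y⁆ ∈ gr h k := by
  rw [mem_gr] at *
  rw [leibniz_lie, hx, hy, smul_lie, lie_smul, ← add_smul, ← hk]
  push_cast
  ring_nf

/-- The component of degree `k` with respect to a homogeneous basis. -/
noncomputable def part [Fintype ι] (t : Module.Basis ι ℝ g) (deg : ι → ℤ) (k : ℤ) : g →ₗ[ℝ] g :=
  ∑ a, if deg a = k then (t.coord a).smulRight (t a) else 0

/-- `t` is a homogeneous basis for the short grading `g = g_{-1} ⊕ g_0 ⊕ g_1` defined by `h`, and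
`B` is a nondegenerate invariant symmetric form. -/
structure ShortGrading (B : LinearMap.BilinForm ℝ g) (t : Module.Basis ι ℝ g) (deg : ι → ℤ)
    (h : g) : Prop where
  symm : ∀ x y, B x y = B y x
  invariant : ∀ x y z, B ⁅x, y⁆ z = B x ⁅y, z⁆
  eq_zero : ∀ x, (∀ y, B x y = 0) → x = 0
  weight : ∀ a, t a ∈ gr h (deg a)
  deg_mem : ∀ a, deg a = -1 ∨ deg a = 0 ∨ deg a = 1

/-- The coordinate functional of `t a` is an eigenvector of the transpose of `ad h` with eigenvalue
`2 deg a`, so it annihilates the other eigenspaces. -/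
lemma repr_eq_zero_of_mem_gr {t : Module.Basis ι ℝ g} {deg : ι → ℤ} {h x : g} {k : ℤ}
    (hw : ∀ a, t a ∈ gr h (deg a)) (hx : x ∈ gr h k) {a : ι} (ha : deg a ≠ k) :
    t.repr x a = 0 := by
  classical
  have key : ∀ z : g, t.coord a ⁅h, z⁆ = 2 * (deg a : ℝ) * t.coord a z := by
    intro z
    have : t.coord a ∘ₗ (LieAlgebra.ad ℝ g h : g →ₗ[ℝ] g) =
        (2 * (deg a : ℝ)) • t.coord a := by
      refine t.ext fun b => ?_
      have hb := hw b
      rw [mem_gr] at hb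
      simp only [LinearMap.comp_apply, LieAlgebra.ad_apply, hb, map_smul, smul_eq_mul,
        LinearMap.smul_apply, Module.Basis.coord_apply, Module.Basis.repr_self]
      by_cases hab : b = a
      · subst hab; rfl
      · simp [hab]
    exact LinearMap.congr_fun this z
  have h1 := key x
  rw [mem_gr] at hx
  rw [hx, map_smul, smul_eq_mul] at h1
  have h2 : ((k : ℝ) - deg a) * t.coord a x = 0 := by linarith
  rcases mul_eq_zero.1 h2 with h3 | h3
  · exact absurd (by exact_mod_cast (sub_eq_zero.1 h3).symm) ha
  · exact h3

section Part

variable [Fintype ι] {t : Module.Basis ι ℝ g} {deg : ι → ℤ} {h : g}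

lemma part_apply (k : ℤ) (x : g) :
    part t deg k x = ∑ a, if deg a = k then t.repr x a • t a else 0 := by
  simp only [part, LinearMap.sum_apply]
  refine Finset.sum_congr rfl fun a _ => ?_
  split_ifs <;> simp

lemma repr_part (k : ℤ) (x : g) (a : ι) :
    t.repr (part t deg k x) a = if deg a = k then t.repr x a else 0 := by
  classical
  rw [part_apply, map_sum, Finset.sum_apply']
  rw [Finset.sum_eq_single a]
  · split_ifs <;> simp
  · intro b _ hb
    split_ifs <;> simp [hb]
  · simp

lemma part_mem (hw : ∀ a, t a ∈ gr h (deg a)) (k : ℤ) (x : g) : part t deg k x ∈ gr h k := by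
  rw [part_apply]
  refine Submodule.sum_mem _ fun a _ => ?_
  split_ifs with ha
  · exact Submodule.smul_mem _ _ (ha ▸ hw a)
  · exact Submodule.zero_mem _

lemma part_of_mem (hw : ∀ a, t a ∈ gr h (deg a)) {k : ℤ} {x : g} (hx : x ∈ gr h k) :
    part t deg k x = x := by
  refine t.repr.injective (Finsupp.ext fun a => ?_)
  rw [repr_part]
  split_ifs with ha
  · rfl
  · exact (repr_eq_zero_of_mem_gr hw hx ha).symm

lemma part_of_mem_ne (hw : ∀ a, t a ∈ gr h (deg a)) {k l : ℤ} {x : g} (hx : x ∈ gr h l)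
    (hkl : k ≠ l) : part t deg k x = 0 := by
  refine t.repr.injective (Finsupp.ext fun a => ?_)
  rw [repr_part]
  split_ifs with ha
  · rw [repr_eq_zero_of_mem_gr hw hx (by omega)]; simp
  · simp

lemma gPlus_eq_of (hw : ∀ a, t a ∈ gr h (deg a)) (hle : ∀ a, deg a ≤ 1) :
    gPlus t deg = gr h 1 := by
  apply le_antisymm
  · rw [gPlus, Submodule.span_le]
    rintro _ ⟨a, ha, rfl⟩
    have : deg a = 1 := le_antisymm (hle a) ha
    exact this ▸ hw a
  · intro x hx
    rw [← part_of_mem hw hx, part_apply]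
    refine Submodule.sum_mem _ fun a _ => ?_
    split_ifs with ha
    · exact Submodule.smul_mem _ _ (Submodule.subset_span ⟨a, by simp [ha], rfl⟩)
    · exact Submodule.zero_mem _

end Part

lemma triple_mem {h e f : g} (ht : IsSl2Triple h e f) : e ∈ gr h 1 ∧ f ∈ gr h (-1) := by
  constructor
  · rw [mem_gr, ht.lie_h_e_smul ℝ]; norm_num
  · rw [mem_gr, ht.lie_lie_smul_f ℝ]; simp

/-- If `g_+` is Abelian, then the grading is short. -/
lemma shortGrading_of_abelian [Fintype ι] {B : LinearMap.BilinForm ℝ g}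
    {t : Module.Basis ι ℝ g} {deg : ι → ℤ} {h e f : g}
    (symm : ∀ x y, B x y = B y x) (invariant : ∀ x y z, B ⁅x, y⁆ z = B x ⁅y, z⁆)
    (eq_zero : ∀ x, (∀ y, B x y = 0) → x = 0) (ht : IsSl2Triple h e f)
    (hw : ∀ a, t a ∈ gr h (deg a))
    (habel : ∀ x ∈ gPlus t deg, ∀ y ∈ gPlus t deg, ⁅x, y⁆ = 0) :
    ShortGrading B t deg h := by
  obtain ⟨he, hf⟩ := triple_mem ht
  have hplus : ∀ k : ℤ, 1 ≤ k → ∀ x ∈ gr h k, x ∈ gPlus t deg := by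
    intro k hk x hx
    rw [← part_of_mem hw hx, part_apply]
    refine Submodule.sum_mem _ fun a _ => ?_
    split_ifs with ha
    · refine Submodule.smul_mem _ _ (Submodule.subset_span ⟨a, ?_, rfl⟩)
      show 0 < deg a
      omega
    · exact Submodule.zero_mem _
  have hkill : ∀ k : ℤ, 1 ≤ k → ∀ x ∈ gr h k, ⁅e, x⁆ = 0 := fun k hk x hx =>
    habel _ (hplus 1 le_rfl e he) _ (hplus k hk x hx)
  -- `⁅f, x⁆` still has positive degree, so `e` kills both it and `x`; expanding by Jacobi leaves
  -- `⁅h, x⁆ = 0`.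
  have hbig : ∀ k : ℤ, 2 ≤ k → ∀ x ∈ gr h k, x = 0 := by
    intro k hk x hx
    have h1 : ⁅e, ⁅f, x⁆⁆ = 0 :=
      hkill (k - 1) (by omega) _ (lie_mem_gr hf hx (by ring))
    rw [leibniz_lie, ht.lie_e_f, hkill k (by omega) x hx, lie_zero, add_zero, mem_gr.1 hx] at h1
    refine (smul_eq_zero.1 h1).resolve_left ?_
    have : (2 : ℝ) ≤ k := by exact_mod_cast hk
    positivity
  have hpair : ∀ i j : ℤ, i + j ≠ 0 → ∀ x ∈ gr h i, ∀ y ∈ gr h j, B x y = 0 := by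
    intro i j hij x hx y hy
    have h1 : B ⁅h, x⁆ y = - B x ⁅h, y⁆ := by
      rw [← lie_skew, map_neg, LinearMap.neg_apply, invariant]
    rw [mem_gr.1 hx, mem_gr.1 hy, map_smul, map_smul, LinearMap.smul_apply, smul_eq_mul,
      smul_eq_mul] at h1
    have h2 : ((i : ℝ) + j) * B x y = 0 := by linarith
    exact (mul_eq_zero.1 h2).resolve_left (by exact_mod_cast hij)
  refine ⟨symm, invariant, eq_zero, hw, fun a => ?_⟩
  by_contra hcon
  push Not at hcon
  obtain ⟨h1, h2, h3⟩ := hcon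
  refine t.ne_zero a ?_
  rcases lt_or_ge (deg a) 2 with hlt | hge
  -- A vector of degree `≤ -2` can only pair with degrees `≥ 2`, which are zero by `hbig`;
  -- nondegeneracy finishes.
  · have hneg : deg a ≤ -2 := by omega
    refine eq_zero _ fun y => ?_
    have : B (t a) = 0 := by
      refine t.ext fun b => ?_
      by_cases hb : deg a + deg b = 0
      · rw [hbig (deg b) (by omega) _ (hw b)]; simp
      · exact hpair _ _ hb _ (hw a) _ (hw b)
    simp [this]
  · exact hbig _ hge _ (hw a)

namespace ShortGrading

variable {B : LinearMap.BilinForm ℝ g} {t : Module.Basis ι ℝ g} {deg : ι → ℤ} {h : g}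

lemma eq_zero_of_mem_gr (hG : ShortGrading B t deg h) {k : ℤ}
    (hk : k ≠ -1 ∧ k ≠ 0 ∧ k ≠ 1) {x : g} (hx : x ∈ gr h k) : x = 0 := by
  refine t.repr.injective (Finsupp.ext fun a => ?_)
  rw [repr_eq_zero_of_mem_gr hG.weight hx (by rcases hG.deg_mem a with h | h | h <;> omega)]
  simp

lemma lie_eq_zero (hG : ShortGrading B t deg h) {x y : g} (hx : x ∈ gr h 1) (hy : y ∈ gr h 1) :
    ⁅x, y⁆ = 0 :=
  hG.eq_zero_of_mem_gr (k := 2) (by norm_num) (lie_mem_gr hx hy (by norm_num))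

lemma lie_neg_eq_zero (hG : ShortGrading B t deg h) {x y : g} (hx : x ∈ gr h (-1))
    (hy : y ∈ gr h (-1)) : ⁅x, y⁆ = 0 :=
  hG.eq_zero_of_mem_gr (k := -2) (by norm_num) (lie_mem_gr hx hy (by norm_num))

variable [Fintype ι]

lemma gPlus_eq (hG : ShortGrading B t deg h) : gPlus t deg = gr h 1 :=
  gPlus_eq_of hG.weight fun a => by rcases hG.deg_mem a with h | h | h <;> omega

lemma sum_part (hG : ShortGrading B t deg h) (x : g) :
    part t deg (-1) x + part t deg 0 x + part t deg 1 x = x := by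
  refine t.repr.injective (Finsupp.ext fun a => ?_)
  simp only [map_add, Finsupp.add_apply, repr_part]
  rcases hG.deg_mem a with h | h | h <;> simp [h]

/-- Three applications of `ad y` raise the degree by 3, beyond the range from `-1` to `1`. -/
lemma ad_cube (hG : ShortGrading B t deg h) {y : g} (hy : y ∈ gr h 1) (x : g) :
    ⁅y, ⁅y, ⁅y, x⁆⁆⁆ = 0 := by
  have key : ∀ k : ℤ, -1 ≤ k → ∀ z ∈ gr h k, ⁅y, ⁅y, ⁅y, z⁆⁆⁆ = 0 := fun k hk z hz =>
    hG.eq_zero_of_mem_gr (k := k + 3) (by omega)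
      (lie_mem_gr hy (lie_mem_gr hy (lie_mem_gr hy hz rfl) rfl) (by ring))
  rw [← hG.sum_part x]
  simp only [lie_add, key _ (by norm_num : (-1 : ℤ) ≤ -1) _ (part_mem hG.weight _ _),
    key _ (by norm_num : (-1 : ℤ) ≤ 0) _ (part_mem hG.weight _ _),
    key _ (by norm_num : (-1 : ℤ) ≤ 1) _ (part_mem hG.weight _ _), add_zero]

lemma expAd_eq (hG : ShortGrading B t deg h) {y : g} (hy : y ∈ gr h 1) (x : g) :
    expAd y x = x + ⁅y, x⁆ + (2⁻¹ : ℝ) • ⁅y, ⁅y, x⁆⁆ := by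
  have h3 : (LieAlgebra.ad ℝ g y) ^ 3 = 0 := by
    ext z
    simp [pow_succ, hG.ad_cube hy]
  have hle : nilpotencyClass (LieAlgebra.ad ℝ g y) ≤ 3 := Nat.sInf_le h3
  -- The nilpotency class may be smaller than 3; the terms added to reach 3 vanish.
  rw [expAd, Finset.sum_subset (Finset.range_mono hle)]
  · simp [Finset.sum_range_succ, pow_succ, Nat.factorial]
  · intro n _ hn
    have : (LieAlgebra.ad ℝ g y) ^ n = 0 :=
      pow_eq_zero_of_le (by simpa using hn) (pow_nilpotencyClass ⟨3, h3⟩)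
    simp [this]

/-- Since `ad y` raises the degree, gauge transformations move points only within a fibre of the
`J_α`. -/
lemma part_neg_expAd (hG : ShortGrading B t deg h) {y : g} (hy : y ∈ gr h 1) (x : g) :
    part t deg (-1) (expAd y x) = part t deg (-1) x := by
  have key : ∀ z, part t deg (-1) ⁅y, z⁆ = 0 := by
    intro z
    rw [← hG.sum_part z, lie_add, lie_add, map_add, map_add]
    rw [part_of_mem_ne hG.weight (lie_mem_gr hy (part_mem hG.weight _ _) rfl) (by norm_num),
      part_of_mem_ne hG.weight (lie_mem_gr hy (part_mem hG.weight _ _) rfl) (by norm_num),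
      part_of_mem_ne hG.weight (lie_mem_gr hy (part_mem hG.weight _ _) rfl) (by norm_num)]
    simp
  rw [hG.expAd_eq hy, map_add, map_add, map_smul, key, key]
  simp

lemma part_zero_expAd (hG : ShortGrading B t deg h) {y : g} (hy : y ∈ gr h 1) (x : g) :
    part t deg 0 (expAd y x) = part t deg 0 x + ⁅y, part t deg (-1) x⁆ := by
  have key : ∀ z, part t deg 0 ⁅y, z⁆ = ⁅y, part t deg (-1) z⁆ := by
    intro z
    conv_lhs => rw [← hG.sum_part z, lie_add, lie_add, map_add, map_add]
    rw [part_of_mem hG.weight (lie_mem_gr hy (part_mem hG.weight _ _) (by norm_num)),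
      part_of_mem_ne hG.weight (lie_mem_gr hy (part_mem hG.weight 0 _) rfl) (by norm_num),
      part_of_mem_ne hG.weight (lie_mem_gr hy (part_mem hG.weight 1 _) rfl) (by norm_num)]
    simp
  have key2 : part t deg (-1) ⁅y, x⁆ = 0 := by
    rw [← hG.sum_part x, lie_add, lie_add, map_add, map_add]
    rw [part_of_mem_ne hG.weight (lie_mem_gr hy (part_mem hG.weight _ _) rfl) (by norm_num),
      part_of_mem_ne hG.weight (lie_mem_gr hy (part_mem hG.weight _ _) rfl) (by norm_num),
      part_of_mem_ne hG.weight (lie_mem_gr hy (part_mem hG.weight _ _) rfl) (by norm_num)]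
    simp
  rw [hG.expAd_eq hy, map_add, map_add, map_smul, key, key, key2]
  simp

lemma expAd_add (hG : ShortGrading B t deg h) {y z : g} (hy : y ∈ gr h 1) (hz : z ∈ gr h 1)
    (x : g) : expAd y (expAd z x) = expAd (y + z) x := by
  have hcomm : ∀ u : g, ⁅z, ⁅y, u⁆⁆ = ⁅y, ⁅z, u⁆⁆ := by
    intro u
    rw [leibniz_lie z y u, hG.lie_eq_zero hz hy, zero_lie, zero_add]
  have hdeg : ∀ a b c : g, a ∈ gr h 1 → b ∈ gr h 1 → c ∈ gr h 1 → ∀ u : g,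
      ⁅a, ⁅b, ⁅c, u⁆⁆⁆ = 0 := by
    intro a b c ha hb hc u
    have key : ∀ k : ℤ, -1 ≤ k → ∀ v ∈ gr h k, ⁅a, ⁅b, ⁅c, v⁆⁆⁆ = 0 := fun k hk v hv =>
      hG.eq_zero_of_mem_gr (k := k + 3) (by omega)
        (lie_mem_gr ha (lie_mem_gr hb (lie_mem_gr hc hv rfl) rfl) (by ring))
    rw [← hG.sum_part u]
    simp only [lie_add, key _ (by norm_num : (-1 : ℤ) ≤ -1) _ (part_mem hG.weight _ _),
      key _ (by norm_num : (-1 : ℤ) ≤ 0) _ (part_mem hG.weight _ _),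
      key _ (by norm_num : (-1 : ℤ) ≤ 1) _ (part_mem hG.weight _ _), add_zero]
  rw [hG.expAd_eq hy, hG.expAd_eq hz, hG.expAd_eq (Submodule.add_mem _ hy hz)]
  simp only [lie_add, add_lie, lie_smul, hcomm, hdeg y y z hy hy hz, hdeg y z z hy hz hz,
    lie_zero, smul_zero]
  module

lemma expAd_zero (hG : ShortGrading B t deg h) (x : g) : expAd (0 : g) x = x := by
  rw [hG.expAd_eq (Submodule.zero_mem _)]
  simp

/-- By invariance `ad y` is skew for `B`; moving every `ad y` to the right factor cancels the terms
of order 1 and 2, and higher orders vanish by `ad_cube`. -/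
lemma form_expAd (hG : ShortGrading B t deg h) {y : g} (hy : y ∈ gr h 1) (u v : g) :
    B (expAd y u) (expAd y v) = B u v := by
  have hD : ∀ a b : g, B ⁅y, a⁆ b = - B a ⁅y, b⁆ := by
    intro a b
    rw [← lie_skew, map_neg, LinearMap.neg_apply, hG.invariant]
  have h3 := hG.ad_cube hy v
  rw [hG.expAd_eq hy, hG.expAd_eq hy]
  simp only [map_add, LinearMap.add_apply, map_smul, LinearMap.smul_apply, smul_eq_mul]
  simp only [hD, h3, map_zero, lie_zero]
  ring

/-- For the derivation `D = ad y` with `D³ = 0`, the truncated exponential is multiplicative once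
the terms of order 3 and 4 vanish. Applying `D³` to `⁅u, v⁆` gives `⁅D²u, Dv⁆ + ⁅Du, D²v⁆ = 0`, and
one more `D` gives `⁅D²u, D²v⁆ = 0`. -/
lemma expAd_lie (hG : ShortGrading B t deg h) {y : g} (hy : y ∈ gr h 1) (u v : g) :
    expAd y ⁅u, v⁆ = ⁅expAd y u, expAd y v⁆ := by
  have e3 := hG.ad_cube hy ⁅u, v⁆
  simp only [leibniz_lie y u, leibniz_lie y ⁅y, u⁆, leibniz_lie y ⁅y, ⁅y, u⁆⁆, lie_add, hG.ad_cube hy, zero_lie, lie_zero, zero_add, add_zero] at e3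
  have e1 : (3 : ℝ) • (⁅⁅y, ⁅y, u⁆⁆, ⁅y, v⁆⁆ + ⁅⁅y, u⁆, ⁅y, ⁅y, v⁆⁆⁆) = 0 := by
    rw [← e3]; module
  have e2 := (smul_eq_zero.1 e1).resolve_left (by norm_num)
  have e4 : (2 : ℝ) • ⁅⁅y, ⁅y, u⁆⁆, ⁅y, ⁅y, v⁆⁆⁆ = 0 := by
    have := congrArg (fun z => ⁅y, z⁆) e2
    simp only [leibniz_lie y ⁅y, u⁆, leibniz_lie y ⁅y, ⁅y, u⁆⁆, lie_add, hG.ad_cube hy, zero_lie,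
      lie_zero, zero_add, add_zero] at this
    rw [← this]; module
  have e5 := (smul_eq_zero.1 e4).resolve_left (by norm_num)
  have e6 : ⁅⁅y, ⁅y, u⁆⁆, ⁅y, v⁆⁆ = - ⁅⁅y, u⁆, ⁅y, ⁅y, v⁆⁆⁆ := eq_neg_of_add_eq_zero_left e2
  rw [hG.expAd_eq hy, hG.expAd_eq hy, hG.expAd_eq hy]
  simp only [leibniz_lie y u, leibniz_lie y ⁅y, u⁆, lie_add, add_lie, lie_smul, smul_lie, e5, e6, smul_zero]
  module

/-- The action of `exp y`, `y ∈ g_+`, as an automorphism. -/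
noncomputable def expAdEquiv (hG : ShortGrading B t deg h) {y : g} (hy : y ∈ gr h 1) :
    g ≃ₗ⁅ℝ⁆ g where
  toFun := expAd y
  invFun := expAd (-y)
  map_add' a b := by simp only [expAd, map_add, smul_add, Finset.sum_add_distrib]
  map_smul' r a := by
    simp only [expAd, map_smul, Finset.smul_sum, RingHom.id_apply]
    exact Finset.sum_congr rfl fun _ _ => smul_comm _ _ _
  map_lie' {a b} := hG.expAd_lie hy a b
  left_inv x := by
    rw [hG.expAd_add (Submodule.neg_mem _ hy) hy, neg_add_cancel, hG.expAd_zero]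
  right_inv x := by
    rw [hG.expAd_add hy (Submodule.neg_mem _ hy), add_neg_cancel, hG.expAd_zero]

end ShortGrading

end Grading

/-! ### Existence and uniqueness of the highest weight gauge. -/

section GaugeFixing

variable {g : Type*} [LieRing g] [LieAlgebra ℝ g] {ι : Type*} {κ : Type*}

/-- A linear left inverse of the coordinates on the highest weight vectors. -/
lemma IsHighestWeightBasis.exists_coord [Fintype κ] {h e : g} {σ : κ → ℤ} {ℓ : κ → g}
    (hℓ : IsHighestWeightBasis h e σ ℓ) :
    ∃ L : g →ₗ[ℝ] (κ → ℝ), (∀ w : κ → ℝ, L (∑ s, w s • ℓ s) = w) ∧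
      ∀ z : g, ⁅e, z⁆ = 0 → ∑ s, L z s • ℓ s = z := by
  obtain ⟨L, hL⟩ := (Fintype.linearCombination ℝ ℓ).exists_leftInverse_of_injective
    (LinearMap.ker_eq_bot.2 hℓ.linearIndependent.fintypeLinearCombination_injective)
  have hL' : ∀ w : κ → ℝ, L (∑ s, w s • ℓ s) = w := fun w => LinearMap.congr_fun hL w
  refine ⟨L, hL', fun z hz => ?_⟩
  have hz' : z ∈ Submodule.span ℝ (Set.range ℓ) := by
    rw [hℓ.span_eq]; simpa using hz
  obtain ⟨w, rfl⟩ := (Submodule.mem_span_range_iff_exists_fun ℝ).1 hz'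
  rw [hL']

lemma IsHighestWeightBasis.lie_eq_zero {h e : g} {σ : κ → ℤ} {ℓ : κ → g}
    (hℓ : IsHighestWeightBasis h e σ ℓ) (s : κ) : ⁅e, ℓ s⁆ = 0 := by
  have : ℓ s ∈ LinearMap.ker (LieAlgebra.ad ℝ g e : g →ₗ[ℝ] g) :=
    hℓ.span_eq ▸ Submodule.subset_span ⟨s, rfl⟩
  simpa using this

/-- The parameter of the gauge transformation which leads to the highest weight gauge. -/
noncomputable def gaugeParam [Fintype ι] (t : Module.Basis ι ℝ g) (deg : ι → ℤ) (e X : g) : g :=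
  (2⁻¹ : ℝ) • ⁅e, part t deg 0 X⁆

/-- The coordinates of degree `≥ 0`. -/
noncomputable def nonnegCoord (t : Module.Basis ι ℝ g) (deg : ι → ℤ) (X : g) : NonnegIdx deg → ℝ :=
  fun a => t.repr X a

namespace ShortGrading

variable {B : LinearMap.BilinForm ℝ g} {t : Module.Basis ι ℝ g} {deg : ι → ℤ} {h : g}

lemma gaugeParam_mem [Fintype ι] (hG : ShortGrading B t deg h) {e : g} (he : e ∈ gr h 1) (X : g) :
    gaugeParam t deg e X ∈ gr h 1 :=
  Submodule.smul_mem _ _ (lie_mem_gr he (part_mem hG.weight _ _) (by norm_num))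

/-- This makes `ad f` injective on `g_1` with an explicit left inverse; uniqueness of the gauge
parameter and of `e` both rest on it. -/
lemma lie_lie_f (hG : ShortGrading B t deg h) {e f y : g} (ht : IsSl2Triple h e f)
    (hy : y ∈ gr h 1) : ⁅e, ⁅y, f⁆⁆ = (-2 : ℝ) • y := by
  rw [leibniz_lie, hG.lie_eq_zero (triple_mem ht).1 hy, zero_lie, zero_add, ht.lie_e_f,
    ← lie_skew, mem_gr.1 hy]
  module

lemma triple_unique (hG : ShortGrading B t deg h) {e e' f : g} (ht : IsSl2Triple h e f)
    (ht' : IsSl2Triple h e' f) : e' = e := by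
  have h1 := hG.lie_lie_f ht (Submodule.sub_mem _ (triple_mem ht').1 (triple_mem ht).1)
  rw [sub_lie, ht.lie_e_f, ht'.lie_e_f, sub_self, lie_zero] at h1
  exact sub_eq_zero.1 ((smul_eq_zero.1 h1.symm).resolve_left (by norm_num))

variable [Fintype ι]

/-- The highest weight gauge is reached by exactly one gauge transformation. -/
lemma lie_expAd_sub_eq_zero_iff (hG : ShortGrading B t deg h) {e f y X : g}
    (ht : IsSl2Triple h e f) (hX : part t deg (-1) X = f) (hy : y ∈ gr h 1) :
    ⁅e, expAd y X - f⁆ = 0 ↔ y = gaugeParam t deg e X := by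
  -- The degree one component, where all terms quadratic in `y` sit, commutes with `e`, so the
  -- condition is linear in `y`.
  have h1 : ⁅e, expAd y X - f⁆ = ⁅e, part t deg 0 X⁆ - (2 : ℝ) • y := by
    rw [← hG.sum_part (expAd y X), hG.part_neg_expAd hy, hG.part_zero_expAd hy, hX]
    have : ⁅e, part t deg 1 (expAd y X)⁆ = 0 :=
      hG.lie_eq_zero (triple_mem ht).1 (part_mem hG.weight _ _)
    simp only [lie_add, lie_sub, this, hG.lie_lie_f ht hy]
    module
  rw [h1, gaugeParam, sub_eq_zero]
  constructor
  · intro h2; rw [h2]; module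
  · intro h2; rw [h2]; module

lemma negElt_negCoord (hG : ShortGrading B t deg h) (x : ι → ℝ) :
    negElt t deg (negCoord deg x) = part t deg (-1) (total t x) := by
  refine t.repr.injective (Finsupp.ext fun a => ?_)
  have ht : total t x = t.equivFun.symm x := by rw [total, Module.Basis.equivFun_symm_apply]
  have h1 : t.repr (total t x) a = x a := by
    rw [ht]; exact congrFun (t.equivFun.apply_symm_apply x) a
  rw [repr_part, h1, negElt, map_sum, Finset.sum_apply']
  simp only [map_smul, Module.Basis.repr_self, Finsupp.smul_apply, smul_eq_mul, negCoord]
  classical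
  split_ifs with ha
  · rw [Finset.sum_eq_single ⟨a, by omega⟩]
    · simp
    · intro b _ hb
      have : (b : ι) ≠ a := fun hab => hb (Subtype.ext hab)
      simp [this]
    · simp
  · refine Finset.sum_eq_zero fun b _ => ?_
    have : (b : ι) ≠ a := by
      rintro rfl
      have := b.2
      rcases hG.deg_mem b with h | h | h <;> omega
    simp [this]

/-- Over a point which belongs to an `sl₂` triple, the highest weight form is reached by a unique
element of `G_+`. -/
lemma existsUnique_highestWeightForm [Fintype κ] (hG : ShortGrading B t deg h) {e : g}
    {σ : κ → ℤ} {ℓ : κ → (NegIdx deg → ℝ) → g} {x : ι → ℝ}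
    (ht : IsSl2Triple h e (negElt t deg (negCoord deg x)))
    (hℓ : IsHighestWeightBasis h e σ (fun s => ℓ s (negCoord deg x))) :
    ∃! p : gPlus t deg × (κ → ℝ), IsHighestWeightForm t deg ℓ x (p.1 : g) p.2 := by
  obtain ⟨L, hL, hL'⟩ := hℓ.exists_coord
  have hX := (hG.negElt_negCoord x).symm
  have hy := hG.gaugeParam_mem (triple_mem ht).1 (total t x)
  have h0 := (hG.lie_expAd_sub_eq_zero_iff ht hX hy).2 rfl
  refine ⟨(⟨gaugeParam t deg e (total t x), hG.gPlus_eq ▸ hy⟩,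
    L (expAd (gaugeParam t deg e (total t x)) (total t x) - negElt t deg (negCoord deg x))), ?_, ?_⟩
  · show _ = _ + _
    rw [hL' _ h0]
    abel
  · rintro ⟨⟨y, hyp⟩, w⟩ hw
    have hw' : expAd y (total t x) - negElt t deg (negCoord deg x) =
        ∑ s, w s • ℓ s (negCoord deg x) := by
      rw [sub_eq_iff_eq_add', show expAd y (total t x) = _ from hw]
    have hy' : y = gaugeParam t deg e (total t x) := by
      refine (hG.lie_expAd_sub_eq_zero_iff ht hX (hG.gPlus_eq ▸ hyp)).1 ?_
      rw [hw', lie_sum]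
      exact Finset.sum_eq_zero fun s _ => by rw [lie_smul, hℓ.lie_eq_zero, smul_zero]
    subst hy'
    refine Prod.ext rfl ?_
    show w = L _
    rw [hw', hL]

end ShortGrading

end GaugeFixing

/-! ### The invariant polynomials and their generators `W_s`. -/

section Generators

variable {g : Type*} [LieRing g] [LieAlgebra ℝ g] {ι : Type*} [Fintype ι] {κ : Type*}
variable {B : LinearMap.BilinForm ℝ g} {t : Module.Basis ι ℝ g} {deg : ι → ℤ} {h : g}

lemma total_eq (t : Module.Basis ι ℝ g) (x : ι → ℝ) : total t x = t.equivFun.symm x := by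
  rw [total, Module.Basis.equivFun_symm_apply]

lemma repr_total (x : ι → ℝ) (a : ι) : t.repr (total t x) a = x a := by
  rw [total_eq]; exact congrFun (t.equivFun.apply_symm_apply x) a

lemma total_constrPt_nonnegCoord (hG : ShortGrading B t deg h) {f X : g}
    (hX : part t deg (-1) X = f) : total t (constrPt t deg f (nonnegCoord t deg X)) = X := by
  refine t.repr.injective (Finsupp.ext fun a => ?_)
  rw [repr_total, constrPt]
  split_ifs with ha
  · rfl
  · rw [← hX, repr_part, if_pos]
    rcases hG.deg_mem a with h | h | h <;> omega

lemma part_neg_total_constrPt (hG : ShortGrading B t deg h) {f : g} (hf : f ∈ gr h (-1))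
    (u : NonnegIdx deg → ℝ) : part t deg (-1) (total t (constrPt t deg f u)) = f := by
  refine t.repr.injective (Finsupp.ext fun a => ?_)
  rw [repr_part, repr_total, constrPt]
  split_ifs with ha ha'
  · omega
  · rfl
  · exact (repr_eq_zero_of_mem_gr hG.weight hf ha).symm

lemma nonnegCoord_total_constrPt {f : g} (u : NonnegIdx deg → ℝ) :
    nonnegCoord t deg (total t (constrPt t deg f u)) = u := by
  funext a
  rw [nonnegCoord, repr_total, constrPt, dif_pos a.2]

/-- The elements of the W-algebra are the polynomials which are invariant under the gauge
transformations. -/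
lemma mem_wAlgebra_iff (hG : ShortGrading B t deg h) {f : g} (hf : f ∈ gr h (-1))
    {p : MvPolynomial (NonnegIdx deg) ℝ} :
    p ∈ wAlgebra t deg f ↔ ∀ y ∈ gr h 1, ∀ X, part t deg (-1) X = f →
      MvPolynomial.eval (nonnegCoord t deg (expAd y X)) p =
        MvPolynomial.eval (nonnegCoord t deg X) p := by
  constructor
  · intro hp y hy X hX
    refine hp y (hG.gPlus_eq ▸ hy) _ _ ?_
    rw [total_constrPt_nonnegCoord hG hX, total_constrPt_nonnegCoord hG]
    rw [hG.part_neg_expAd hy, hX]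
  · intro hp y hy u u' huu
    have := hp y (hG.gPlus_eq ▸ hy) _ (part_neg_total_constrPt hG hf u)
    rwa [← huu, nonnegCoord_total_constrPt, nonnegCoord_total_constrPt] at this

/-- A vector valued function all of whose coordinates are polynomials. -/
def IsPolyMap {ν : Type*} (v : (ν → ℝ) → g) : Prop :=
  ∀ φ : g →ₗ[ℝ] ℝ, ∃ P : MvPolynomial ν ℝ, ∀ u, MvPolynomial.eval u P = φ (v u)

namespace IsPolyMap

variable {ν : Type*} {v w : (ν → ℝ) → g}

lemma const (z : g) : IsPolyMap (fun _ : ν → ℝ => z) := fun φ =>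
  ⟨MvPolynomial.C (φ z), fun u => by simp⟩

lemma add (hv : IsPolyMap v) (hw : IsPolyMap w) : IsPolyMap (fun u => v u + w u) := by
  intro φ
  obtain ⟨P, hP⟩ := hv φ
  obtain ⟨Q, hQ⟩ := hw φ
  exact ⟨P + Q, fun u => by simp [hP, hQ]⟩

lemma map (hv : IsPolyMap v) (T : g →ₗ[ℝ] g) : IsPolyMap (fun u => T (v u)) :=
  fun φ => hv (φ ∘ₗ T)

lemma lie (t : Module.Basis ι ℝ g) (hv : IsPolyMap v) (hw : IsPolyMap w) :
    IsPolyMap (fun u => ⁅v u, w u⁆) := by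
  intro φ
  choose P hP using fun a => hv (t.coord a)
  choose Q hQ using fun a => hw (t.coord a)
  refine ⟨∑ a, ∑ b, MvPolynomial.C (φ ⁅t a, t b⁆) * (P a * Q b), fun u => ?_⟩
  show _ = φ ⁅v u, w u⁆
  conv_rhs => rw [← t.sum_repr (v u), ← t.sum_repr (w u)]
  rw [sum_lie, map_sum, map_sum]
  refine Finset.sum_congr rfl fun a _ => ?_
  rw [lie_sum, map_sum, map_sum]
  refine Finset.sum_congr rfl fun b _ => ?_
  simp only [map_mul, MvPolynomial.eval_C, hP, hQ, smul_lie, lie_smul, map_smul, smul_eq_mul,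
    Module.Basis.coord_apply]
  ring

end IsPolyMap

lemma isPolyMap_total_constrPt (f : g) :
    IsPolyMap (fun u => total t (constrPt t deg f u)) := by
  intro φ
  refine ⟨∑ a, (if ha : 0 ≤ deg a then MvPolynomial.X ⟨a, ha⟩ else
    MvPolynomial.C (t.repr f a)) * MvPolynomial.C (φ (t a)), fun u => ?_⟩
  simp only [total, map_sum, map_smul, map_mul, MvPolynomial.eval_C, smul_eq_mul]
  refine Finset.sum_congr rfl fun a _ => ?_
  rw [constrPt]
  split_ifs <;> simp

/-- The generators of the W-algebra. -/
lemma exists_generators [Fintype κ] (hG : ShortGrading B t deg h) {e f : g}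
    (ht : IsSl2Triple h e f) (L : g →ₗ[ℝ] (κ → ℝ)) :
    ∃ W : κ → wAlgebra t deg f, ∀ X, part t deg (-1) X = f → ∀ s,
      MvPolynomial.eval (nonnegCoord t deg X) (W s : MvPolynomial (NonnegIdx deg) ℝ) =
        L (expAd (gaugeParam t deg e X) X - f) s := by
  obtain ⟨he, hf⟩ := triple_mem ht
  have hX := isPolyMap_total_constrPt (t := t) (deg := deg) f
  have hy : IsPolyMap (fun u => gaugeParam t deg e (total t (constrPt t deg f u))) :=
    ((IsPolyMap.const e).lie t (hX.map (part t deg 0))).map ((2⁻¹ : ℝ) • LinearMap.id)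
  have hF : IsPolyMap (fun u => expAd (gaugeParam t deg e (total t (constrPt t deg f u)))
      (total t (constrPt t deg f u)) - f) := by
    have h1 := ((hX.add (hy.lie t hX)).add
      ((hy.lie t (hy.lie t hX)).map ((2⁻¹ : ℝ) • LinearMap.id))).add (IsPolyMap.const (-f))
    convert h1 using 2 with u
    rw [hG.expAd_eq (hG.gaugeParam_mem he _), sub_eq_add_neg]
    rfl
  choose P hP using fun s => hF (LinearMap.proj s ∘ₗ L)
  have hP' : ∀ s X, part t deg (-1) X = f → MvPolynomial.eval (nonnegCoord t deg X) (P s) =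
      L (expAd (gaugeParam t deg e X) X - f) s := by
    intro s X hX
    rw [hP]
    simp only [total_constrPt_nonnegCoord hG hX]
    rfl
  refine ⟨fun s => ⟨P s, (mem_wAlgebra_iff hG hf).2 fun y hy X hX => ?_⟩, fun X hX s => hP' s X hX⟩
  rw [hP' s X hX, hP' s _ (by rw [hG.part_neg_expAd hy, hX])]
  have hX' : part t deg (-1) (expAd y X) = f := by rw [hG.part_neg_expAd hy, hX]
  -- Fixing the gauge of `expAd y X` amounts to acting on `X` by the sum of two parameters; by
  -- uniqueness this sum is the parameter of `X`, so both points have the same normal form.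
  have h1 := (hG.lie_expAd_sub_eq_zero_iff ht hX' (hG.gaugeParam_mem he _)).2 rfl
  have h2 := hG.gaugeParam_mem he (expAd y X)
  rw [hG.expAd_add h2 hy, hG.lie_expAd_sub_eq_zero_iff ht hX (Submodule.add_mem _ h2 hy)] at h1
  rw [hG.expAd_add h2 hy, h1]

/-- The generators are the coordinates of the highest weight gauge. -/
def IsSliceGenerators [Fintype κ] (t : Module.Basis ι ℝ g) (deg : ι → ℤ) (e f : g) (ℓ : κ → g)
    (W : κ → wAlgebra t deg f) : Prop :=
  ∀ X, part t deg (-1) X = f → expAd (gaugeParam t deg e X) X =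
    f + ∑ s, MvPolynomial.eval (nonnegCoord t deg X)
      (W s : MvPolynomial (NonnegIdx deg) ℝ) • ℓ s

lemma exists_sliceGenerators [Fintype κ] (hG : ShortGrading B t deg h) {e f : g}
    (ht : IsSl2Triple h e f) {σ : κ → ℤ} {ℓ : κ → g} (hℓ : IsHighestWeightBasis h e σ ℓ) :
    ∃ W : κ → wAlgebra t deg f, IsSliceGenerators t deg e f ℓ W := by
  obtain ⟨L, -, hL⟩ := hℓ.exists_coord
  obtain ⟨W, hW⟩ := exists_generators hG ht L
  refine ⟨W, fun X hX => ?_⟩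
  simp only [hW X hX]
  rw [hL _ ((hG.lie_expAd_sub_eq_zero_iff ht hX (hG.gaugeParam_mem (triple_mem ht).1 _)).2 rfl)]
  abel

variable [Fintype κ] {e f : g} {ℓ : κ → g} {W : κ → wAlgebra t deg f}

lemma IsSliceGenerators.isGaugeGenerators (hG : ShortGrading B t deg h)
    (ht : IsSl2Triple h e f) (hW : IsSliceGenerators t deg e f ℓ W) :
    IsGaugeGenerators t deg f ℓ W := by
  intro u
  have := hW _ (part_neg_total_constrPt hG (triple_mem ht).2 u)
  rw [nonnegCoord_total_constrPt] at this
  exact ⟨_, hG.gPlus_eq ▸ hG.gaugeParam_mem (triple_mem ht).1 _, this⟩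

/-- An element of the W-algebra is determined by its values in the highest weight gauge. -/
lemma IsSliceGenerators.eval_eq (hG : ShortGrading B t deg h)
    (ht : IsSl2Triple h e f) (hW : IsSliceGenerators t deg e f ℓ W) (p : wAlgebra t deg f)
    {X : g} (hX : part t deg (-1) X = f) :
    MvPolynomial.eval (nonnegCoord t deg X) (p : MvPolynomial (NonnegIdx deg) ℝ) =
      MvPolynomial.eval (nonnegCoord t deg (f + ∑ s, MvPolynomial.eval (nonnegCoord t deg X)
        (W s : MvPolynomial (NonnegIdx deg) ℝ) • ℓ s))
        (p : MvPolynomial (NonnegIdx deg) ℝ) := by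
  rw [← hW X hX]
  exact ((mem_wAlgebra_iff hG (triple_mem ht).2).1 p.2 _
    (hG.gaugeParam_mem (triple_mem ht).1 _) X hX).symm

/-- An invariant equals its value at the gauge-fixed point `f + ∑ W_s ℓ^s`, whose coordinates `G a`
are affine in the `W_s`; substituting them writes `p` as a polynomial in the generators. -/
lemma IsSliceGenerators.adjoin_eq_top (hG : ShortGrading B t deg h)
    (ht : IsSl2Triple h e f) (hW : IsSliceGenerators t deg e f ℓ W) :
    Algebra.adjoin ℝ (Set.range W) = ⊤ := by
  refine Algebra.eq_top_iff.2 fun p => ?_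
  let G : NonnegIdx deg → wAlgebra t deg f := fun a =>
    algebraMap ℝ _ (t.repr f a) + ∑ s, t.repr (ℓ s) a • W s
  have hp : p = MvPolynomial.aeval G (p : MvPolynomial (NonnegIdx deg) ℝ) := by
    refine Subtype.ext (MvPolynomial.funext fun u => ?_)
    have h1 := hW.eval_eq hG ht p (part_neg_total_constrPt hG (triple_mem ht).2 u)
    rw [nonnegCoord_total_constrPt] at h1
    have h2 : ((MvPolynomial.aeval G (p : MvPolynomial (NonnegIdx deg) ℝ) : wAlgebra t deg f) :
        MvPolynomial (NonnegIdx deg) ℝ) =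
        MvPolynomial.aeval (fun a => (G a : MvPolynomial (NonnegIdx deg) ℝ)) p.1 :=
      MvPolynomial.comp_aeval_apply G (wAlgebra t deg f).val p.1
    have h3 : MvPolynomial.eval u (MvPolynomial.aeval
        (fun a => (G a : MvPolynomial (NonnegIdx deg) ℝ)) p.1) =
        MvPolynomial.eval (fun a => MvPolynomial.eval u (G a).1) p.1 :=
      MvPolynomial.comp_aeval_apply (fun a => (G a).1) (MvPolynomial.aeval u) p.1
    rw [h1, h2, h3]
    congr 2
    funext a
    simp [G, nonnegCoord, MvPolynomial.algebraMap_eq, MvPolynomial.smul_eval, mul_comm]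
  have hGa : ∀ a, G a ∈ Algebra.adjoin ℝ (Set.range W) := fun a =>
    Subalgebra.add_mem _ (Subalgebra.algebraMap_mem _ _) (Subalgebra.sum_mem _ fun s _ =>
      Subalgebra.smul_mem _ (Algebra.subset_adjoin (Set.mem_range_self s)) _)
  rw [hp, MvPolynomial.aeval_def, MvPolynomial.eval₂_eq]
  exact Subalgebra.sum_mem _ fun m _ => Subalgebra.mul_mem _ (Subalgebra.algebraMap_mem _ _)
    (Subalgebra.prod_mem _ fun a _ => Subalgebra.pow_mem _ (hGa a) _)

end Generators

/-- `ad h` is skew, so pairing `⁅h, v⁆ - 2 v` with `t b` gives `-2 (deg b + 1)` times `B v (t b)`;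
one of the two factors is always zero. -/
lemma ShortGrading.mem_gr_one_of_form {g : Type*} [LieRing g] [LieAlgebra ℝ g] {ι : Type*}
    {B : LinearMap.BilinForm ℝ g} {t : Module.Basis ι ℝ g} {deg : ι → ℤ} {h : g}
    (hG : ShortGrading B t deg h) {v : g}
    (hv : ∀ b, deg b ≠ -1 → B v (t b) = 0) : v ∈ gr h 1 := by
  rw [mem_gr, ← sub_eq_zero]
  refine hG.eq_zero _ fun y => ?_
  have : B (⁅h, v⁆ - (2 * ((1 : ℤ) : ℝ)) • v) = 0 := by
    refine t.ext fun b => ?_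
    rw [map_sub, LinearMap.sub_apply, ← lie_skew, map_neg, LinearMap.neg_apply, hG.invariant,
      mem_gr.1 (hG.weight b), map_smul, map_smul, LinearMap.smul_apply, smul_eq_mul, smul_eq_mul,
      LinearMap.zero_apply]
    by_cases hb : deg b = -1
    · rw [hb]; push_cast; ring
    · rw [hv b hb]; ring
  rw [this, LinearMap.zero_apply]

/-! ### The Poisson bracket through gradients, and its invariance under fibrewise conjugation. -/

section Poisson

variable {g : Type*} [LieRing g] [LieAlgebra ℝ g] {ι : Type*} [Fintype ι] [DecidableEq ι]
variable {B : LinearMap.BilinForm ℝ g} {t : Module.Basis ι ℝ g} {deg : ι → ℤ} {h : g}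

/-- The basis dual to `t` with respect to the form `B`. -/
noncomputable def dualVec (B : LinearMap.BilinForm ℝ g) (t : Module.Basis ι ℝ g) (a : ι) : g :=
  ∑ b, (metric B t)⁻¹ a b • t b

/-- The gradient of a function of the coordinates, with respect to the form `B`. -/
noncomputable def grad (B : LinearMap.BilinForm ℝ g) (t : Module.Basis ι ℝ g) (F : (ι → ℝ) → ℝ)
    (x : ι → ℝ) : g :=
  ∑ a, fderiv ℝ F x (Pi.single a 1) • dualVec B t a

/-- The coordinate-free Lie–Poisson form of the bracket: the lowered structure constants are those
of the dual basis `dualVec`, paired with the `t c`. -/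
lemma poisson_eq (F H : (ι → ℝ) → ℝ) (x : ι → ℝ) :
    poisson B t F H x = B (total t x) ⁅grad B t F x, grad B t H x⁆ := by
  have h1 : ∀ a b, B (total t x) ⁅dualVec B t a, dualVec B t b⁆ =
      ∑ c, lowStruct B t a b c * x c := by
    intro a b
    have h2 : ∀ c, B (t c) ⁅dualVec B t a, dualVec B t b⁆ = lowStruct B t a b c := by
      intro c
      simp only [dualVec, lowStruct, sum_lie, lie_sum, smul_lie, lie_smul, map_sum, map_smul,
        smul_eq_mul]
      simp only [Finset.mul_sum]
      rw [Finset.sum_comm]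
      refine Finset.sum_congr rfl fun d _ => Finset.sum_congr rfl fun b' _ => ?_
      conv_lhs => rw [← t.sum_repr ⁅t d, t b'⁆, map_sum]
      simp only [map_smul, smul_eq_mul, Finset.mul_sum, metric, Matrix.of_apply]
      exact Finset.sum_congr rfl fun k _ => by ring
    simp only [total, map_sum, map_smul, LinearMap.sum_apply, LinearMap.smul_apply, h2,
      smul_eq_mul]
    exact Finset.sum_congr rfl fun k _ => mul_comm _ _
  simp only [poisson, grad, ← h1]
  simp only [sum_lie_sum, smul_lie, lie_smul, map_sum, map_smul, smul_eq_mul]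
  exact Finset.sum_congr rfl fun a _ => Finset.sum_congr rfl fun b _ => by ring

namespace ShortGrading

lemma form_dualVec (hG : ShortGrading B t deg h) (a b : ι) :
    B (dualVec B t a) (t b) = if a = b then 1 else 0 := by
  have hdet : IsUnit (metric B t).det := by
    rw [isUnit_iff_ne_zero]
    intro h0
    obtain ⟨v, hv, hv'⟩ := Matrix.exists_vecMul_eq_zero_iff.2 h0
    refine hv ?_
    have h1 : total t v = 0 := by
      refine hG.eq_zero _ fun y => ?_
      have : B (total t v) = 0 := by
        refine t.ext fun b => ?_
        have := congrFun hv' b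
        simpa [Matrix.vecMul, dotProduct, metric, total] using this
      simp [this]
    rw [total_eq] at h1
    exact (LinearEquiv.map_eq_zero_iff _).1 h1
  have h1 := congrFun (congrFun (Matrix.nonsing_inv_mul _ hdet) a) b
  rw [Matrix.mul_apply, Matrix.one_apply] at h1
  rw [← h1]
  simp [dualVec, metric]

lemma form_grad (hG : ShortGrading B t deg h) (F : (ι → ℝ) → ℝ) (x : ι → ℝ) (z : g) :
    B (grad B t F x) z = fderiv ℝ F x (t.equivFun z) := by
  have : B (grad B t F x) =
      (fderiv ℝ F x : (ι → ℝ) →ₗ[ℝ] ℝ) ∘ₗ (t.equivFun : g →ₗ[ℝ] (ι → ℝ)) := by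
    refine t.ext fun b => ?_
    simp only [grad, map_sum, map_smul, LinearMap.sum_apply, LinearMap.smul_apply,
      hG.form_dualVec, smul_eq_mul, mul_ite, mul_one, mul_zero, Finset.sum_ite_eq',
      Finset.mem_univ, if_true, LinearMap.comp_apply]
    show _ = fderiv ℝ F x (t.equivFun (t b))
    congr 1
    funext c
    simp [Pi.single_apply, eq_comm]
  rw [this]
  rfl

/-- A function which is invariant under the gauge transformations at a point is annihilated there
by the infinitesimal gauge transformations. -/
lemma form_lie_grad_eq_zero (hG : ShortGrading B t deg h) {F : (ι → ℝ) → ℝ} {x : ι → ℝ}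
    (hF : DifferentiableAt ℝ F x)
    (hinv : ∀ y ∈ gr h 1, F (t.equivFun (expAd y (total t x))) = F x) {y : g} (hy : y ∈ gr h 1) :
    B (total t x) ⁅y, grad B t F x⁆ = 0 := by
  have h1 : B (total t x) ⁅y, grad B t F x⁆ = - fderiv ℝ F x (t.equivFun ⁅y, total t x⁆) := by
    rw [← hG.form_grad, ← hG.invariant, ← lie_skew, map_neg, LinearMap.neg_apply, hG.symm]
  rw [h1, neg_eq_zero]
  set v := t.equivFun ⁅y, total t x⁆
  set w := t.equivFun ((2⁻¹ : ℝ) • ⁅y, ⁅y, total t x⁆⁆)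
  have hpath : ∀ s : ℝ, t.equivFun (expAd (s • y) (total t x)) = x + s • v + s ^ 2 • w := by
    intro s
    rw [hG.expAd_eq (Submodule.smul_mem _ _ hy), map_add, map_add, total_eq,
      LinearEquiv.apply_symm_apply, ← total_eq]
    simp only [v, w, smul_lie, lie_smul, map_smul]
    module
  have hd : HasDerivAt (fun s : ℝ => x + s • v + s ^ 2 • w) v 0 := by
    have := (((hasDerivAt_id (0 : ℝ)).smul_const v).const_add x).add
      (((hasDerivAt_id (0 : ℝ)).pow 2).smul_const w)
    exact this.congr_deriv (by simp)
  -- `F` is constant along the gauge orbit `s ↦ exp (s y)`, a quadratic curve through `x` with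
  -- velocity `⁅y, J⁆`.
  have hc : HasDerivAt (fun s : ℝ => F (x + s • v + s ^ 2 • w)) (fderiv ℝ F x v) 0 := by
    have hx : HasFDerivAt F (fderiv ℝ F x) (x + (0 : ℝ) • v + (0 : ℝ) ^ 2 • w) := by
      simpa using hF.hasFDerivAt
    exact hx.comp_hasDerivAt (0 : ℝ) hd
  have hconst : (fun s : ℝ => F (x + s • v + s ^ 2 • w)) = fun _ => F x := by
    funext s
    rw [← hpath, hinv _ (Submodule.smul_mem _ _ hy)]
  rw [hconst] at hc
  exact hc.unique (hasDerivAt_const _ _)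

/-- The gradients of two functions whose restrictions to a constraint surface correspond under an
isometric automorphism correspond up to an element of `g_+`. -/
lemma grad_sub_mem (hG : ShortGrading B t deg h) {F P : (ι → ℝ) → ℝ} {x : ι → ℝ}
    (ψ : g ≃ₗ⁅ℝ⁆ g) (hψ : ∀ u v, B (ψ u) (ψ v) = B u v)
    (hF : DifferentiableAt ℝ F x)
    (hP : DifferentiableAt ℝ P (t.equivFun (ψ.symm (total t x))))
    (hFP : ∀ z, negCoord deg z = negCoord deg x → F z = P (t.equivFun (ψ.symm (total t z)))) :
    grad B t F x - ψ (grad B t P (t.equivFun (ψ.symm (total t x)))) ∈ gr h 1 := by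
  refine hG.mem_gr_one_of_form fun b hb => ?_
  have h1 : B (ψ (grad B t P (t.equivFun (ψ.symm (total t x))))) (t b) =
      fderiv ℝ P (t.equivFun (ψ.symm (total t x))) (t.equivFun (ψ.symm (t b))) := by
    rw [← hG.form_grad, ← hψ _ (ψ.symm (t b)), LieEquiv.apply_symm_apply]
  rw [map_sub, LinearMap.sub_apply, h1, hG.form_grad, sub_eq_zero]
  set x' := t.equivFun (ψ.symm (total t x))
  set v' := t.equivFun (ψ.symm (t b))
  have hd : ∀ p v : ι → ℝ, HasDerivAt (fun s : ℝ => p + s • v) v 0 := by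
    intro p v
    have := ((hasDerivAt_id (0 : ℝ)).smul_const v).const_add p
    exact this.congr_deriv (by simp)
  have hc : HasDerivAt (fun s : ℝ => F (x + s • t.equivFun (t b)))
      (fderiv ℝ F x (t.equivFun (t b))) 0 := by
    have hx : HasFDerivAt F (fderiv ℝ F x) (x + (0 : ℝ) • t.equivFun (t b)) := by
      simpa using hF.hasFDerivAt
    exact hx.comp_hasDerivAt (0 : ℝ) (hd _ _)
  have hc' : HasDerivAt (fun s : ℝ => P (x' + s • v')) (fderiv ℝ P x' v') 0 := by
    have hx : HasFDerivAt P (fderiv ℝ P x') (x' + (0 : ℝ) • v') := by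
      simpa using hP.hasFDerivAt
    exact hx.comp_hasDerivAt (0 : ℝ) (hd _ _)
  -- A direction `t b` with `deg b ≠ -1` stays inside the fibre, the only place where `F` and `P`
  -- are compared.
  have heq : (fun s : ℝ => F (x + s • t.equivFun (t b))) = fun s => P (x' + s • v') := by
    funext s
    rw [hFP]
    · congr 1
      simp only [x', v', total_eq, map_add, map_smul, LinearEquiv.symm_apply_apply]
    · funext α
      have : (α : ι) ≠ b := by
        rintro rfl
        have := α.2
        rcases hG.deg_mem α with h | h | h <;> omega
      simp [negCoord, this.symm]
  rw [heq] at hc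
  exact hc.unique hc'

/-- The gradients of `F` and `H` differ from the transported ones by `a, a' ∈ g_1`. The terms with a
single `a` or `a'` vanish by infinitesimal gauge invariance and `⁅a, a'⁆ = 0`. The functions need to
correspond under `ψ` on one fibre only, so `ψ` may vary with the fibre. -/
lemma poisson_eq_of_conj (hG : ShortGrading B t deg h) {F H P Q : (ι → ℝ) → ℝ} {x : ι → ℝ}
    (ψ : g ≃ₗ⁅ℝ⁆ g) (hψ : ∀ u v, B (ψ u) (ψ v) = B u v)
    (hF : DifferentiableAt ℝ F x) (hH : DifferentiableAt ℝ H x)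
    (hP : DifferentiableAt ℝ P (t.equivFun (ψ.symm (total t x))))
    (hQ : DifferentiableAt ℝ Q (t.equivFun (ψ.symm (total t x))))
    (hFP : ∀ z, negCoord deg z = negCoord deg x → F z = P (t.equivFun (ψ.symm (total t z))))
    (hHQ : ∀ z, negCoord deg z = negCoord deg x → H z = Q (t.equivFun (ψ.symm (total t z))))
    (hFinv : ∀ y ∈ gr h 1, F (t.equivFun (expAd y (total t x))) = F x)
    (hHinv : ∀ y ∈ gr h 1, H (t.equivFun (expAd y (total t x))) = H x) :
    poisson B t F H x = poisson B t P Q (t.equivFun (ψ.symm (total t x))) := by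
  have ha := hG.grad_sub_mem ψ hψ hF hP hFP
  have ha' := hG.grad_sub_mem ψ hψ hH hQ hHQ
  have htot : total t (t.equivFun (ψ.symm (total t x))) = ψ.symm (total t x) := by
    rw [total_eq, LinearEquiv.symm_apply_apply]
  rw [poisson_eq, poisson_eq, htot]
  set p := grad B t P (t.equivFun (ψ.symm (total t x)))
  set q := grad B t Q (t.equivFun (ψ.symm (total t x)))
  have h1 : B (ψ.symm (total t x)) ⁅p, q⁆ = B (total t x) ⁅ψ p, ψ q⁆ := by
    rw [← hψ, LieEquiv.apply_symm_apply, LieEquiv.map_lie]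
  rw [h1]
  set a := grad B t F x - ψ p
  set a' := grad B t H x - ψ q
  have e1 : ψ p = grad B t F x - a := by simp [a]
  have e2 : ψ q = grad B t H x - a' := by simp [a']
  have z1 := hG.form_lie_grad_eq_zero hH hHinv ha
  have z2 := hG.form_lie_grad_eq_zero hF hFinv ha'
  have z3 : ⁅a, a'⁆ = 0 := hG.lie_eq_zero ha ha'
  rw [← lie_skew, map_neg, neg_eq_zero] at z2
  rw [e1, e2]
  simp only [lie_sub, sub_lie, map_sub, z1, z2, z3, map_zero]
  ring

end ShortGrading

lemma hasFDerivAt_eval (P : MvPolynomial ι ℝ) (x : ι → ℝ) :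
    HasFDerivAt (fun z => MvPolynomial.eval z P)
      (∑ a, MvPolynomial.eval x (MvPolynomial.pderiv a P) •
        (ContinuousLinearMap.proj a : (ι → ℝ) →L[ℝ] ℝ)) x := by
  induction P using MvPolynomial.induction_on with
  | C r => simpa using hasFDerivAt_const r x
  | add p q hp hq =>
    simp only [map_add, add_smul, Finset.sum_add_distrib]
    exact hp.add hq
  | mul_X p b hp =>
    have h1 := hp.mul (ContinuousLinearMap.proj b : (ι → ℝ) →L[ℝ] ℝ).hasFDerivAt
    have h2 : (fun z => MvPolynomial.eval z (p * MvPolynomial.X b)) =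
        (fun z => MvPolynomial.eval z p) * ⇑(ContinuousLinearMap.proj b : (ι → ℝ) →L[ℝ] ℝ) := by
      funext z; simp
    rw [h2]
    refine h1.congr_fderiv ?_
    ext v
    simp only [Derivation.leibniz, MvPolynomial.pderiv_X, Pi.single_apply, apply_ite, smul_eq_mul,
      map_add, map_mul, map_zero, MvPolynomial.eval_X, add_smul, Finset.sum_add_distrib,
      add_apply, sum_apply, smul_apply,
      ContinuousLinearMap.proj_apply, Finset.mul_sum, mul_one, mul_zero, ite_mul, zero_mul]
    simp [mul_assoc]

lemma eval_polyPoisson (P Q : MvPolynomial ι ℝ) (x : ι → ℝ) :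
    MvPolynomial.eval x (polyPoisson B t P Q) =
      poisson B t (fun z => MvPolynomial.eval z P) (fun z => MvPolynomial.eval z Q) x := by
  have h1 : ∀ (R : MvPolynomial ι ℝ) a,
      fderiv ℝ (fun z => MvPolynomial.eval z R) x (Pi.single a 1) =
        MvPolynomial.eval x (MvPolynomial.pderiv a R) := by
    intro R a
    rw [(hasFDerivAt_eval R x).fderiv]
    simp [Pi.single_apply]
  simp only [polyPoisson, poisson, map_sum, map_mul, h1, MvPolynomial.eval_C, MvPolynomial.eval_X]

lemma eval_constrBracket {f : g} (p q : MvPolynomial (NonnegIdx deg) ℝ)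
    (u : NonnegIdx deg → ℝ) :
    MvPolynomial.eval u (constrBracket B t deg f p q) =
      poisson B t (fun z => MvPolynomial.eval (fun a : NonnegIdx deg => z a) p)
        (fun z => MvPolynomial.eval (fun a : NonnegIdx deg => z a) q) (constrPt t deg f u) := by
  have h1 : ∀ P : MvPolynomial ι ℝ, MvPolynomial.eval u (imposeConstr t deg f P) =
      MvPolynomial.eval (constrPt t deg f u) P := by
    intro P
    have := MvPolynomial.comp_aeval_apply (R := ℝ) (fun a => if ha : 0 ≤ deg a then
      (MvPolynomial.X ⟨a, ha⟩ : MvPolynomial (NonnegIdx deg) ℝ) else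
      MvPolynomial.C (t.repr f a)) (MvPolynomial.aeval u) P
    refine this.trans ?_
    show MvPolynomial.aeval _ P = MvPolynomial.aeval _ P
    congr 2
    funext a
    rw [constrPt]
    split_ifs <;> simp
  rw [constrBracket, h1, eval_polyPoisson]
  congr 1 <;> · funext z; rw [MvPolynomial.eval_rename]; rfl

lemma differentiable_eval_nonneg (p : MvPolynomial (NonnegIdx deg) ℝ) :
    Differentiable ℝ (fun z : ι → ℝ => MvPolynomial.eval (fun a : NonnegIdx deg => z a) p) := by
  intro x
  have := (hasFDerivAt_eval (MvPolynomial.rename Subtype.val p) x).differentiableAt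
  simp only [MvPolynomial.eval_rename] at this
  exact this

/-- The W-algebra is closed under its bracket. -/
lemma constrBracket_mem (hG : ShortGrading B t deg h) {f : g} (hf : f ∈ gr h (-1))
    (p q : wAlgebra t deg f) : constrBracket B t deg f p q ∈ wAlgebra t deg f := by
  rw [mem_wAlgebra_iff hG hf]
  intro y hy X hX
  have hy' : -y ∈ gr h 1 := Submodule.neg_mem _ hy
  have hX' : part t deg (-1) (expAd y X) = f := by rw [hG.part_neg_expAd hy, hX]
  have hpt : ∀ Z, part t deg (-1) Z = f →
      constrPt t deg f (nonnegCoord t deg Z) = t.equivFun Z := by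
    intro Z hZ
    rw [← LinearEquiv.symm_apply_eq, ← total_eq, total_constrPt_nonnegCoord hG hZ]
  have hinv : ∀ r : wAlgebra t deg f, ∀ y ∈ gr h 1, ∀ Z, part t deg (-1) Z = f →
      MvPolynomial.eval (fun a : NonnegIdx deg => t.equivFun (expAd y Z) a) r.1 =
        MvPolynomial.eval (fun a : NonnegIdx deg => t.equivFun Z a) r.1 :=
    fun r => (mem_wAlgebra_iff hG hf).1 r.2
  have htot : ∀ Z, total t (t.equivFun Z) = Z := fun Z => by
    rw [total_eq, LinearEquiv.symm_apply_apply]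
  have hneg : ∀ z, negCoord deg z = negCoord deg (t.equivFun X) →
      part t deg (-1) (total t z) = f := by
    intro z hz
    rw [← hG.negElt_negCoord, hz, hG.negElt_negCoord, htot, hX]
  have hFP : ∀ (r : wAlgebra t deg f) (z : ι → ℝ),
      negCoord deg z = negCoord deg (t.equivFun X) →
      MvPolynomial.eval (fun a : NonnegIdx deg => z a) r.1 =
      MvPolynomial.eval (fun a : NonnegIdx deg =>
        t.equivFun ((hG.expAdEquiv hy').symm (total t z)) a) r.1 := by
    intro r z hz
    have h1 : (hG.expAdEquiv hy').symm (total t z) = expAd y (total t z) := by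
      show expAd (- -y) _ = _
      rw [neg_neg]
    rw [h1, hinv r y hy _ (hneg z hz), total_eq, LinearEquiv.apply_symm_apply]
  have h2 : (hG.expAdEquiv hy').symm (total t (t.equivFun X)) = expAd y X := by
    rw [htot]
    show expAd (- -y) _ = _
    rw [neg_neg]
  rw [eval_constrBracket, eval_constrBracket, hpt _ hX, hpt _ hX']
  -- A gauge transformation is itself an isometric automorphism preserving the fibre; taking `exp
  -- (-y)` for `ψ` makes `ψ.symm` move `X` to `expAd y X`.
  have key := hG.poisson_eq_of_conj (x := t.equivFun X) (hG.expAdEquiv hy') (hG.form_expAd hy')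
    (differentiable_eval_nonneg p.1 _) (differentiable_eval_nonneg q.1 _)
    (differentiable_eval_nonneg p.1 _) (differentiable_eval_nonneg q.1 _)
    (hFP p) (hFP q) (fun y hy => by rw [htot]; exact hinv p y hy X hX)
    (fun y hy => by rw [htot]; exact hinv q y hy X hX)
  rw [key, h2]

end Poisson

/-! ### Exponentials of operators obeying a Leibniz rule. -/

section Exponential

variable {E₁ E₂ E₃ : Type*} [NormedAddCommGroup E₁] [NormedSpace ℝ E₁] [CompleteSpace E₁]
  [NormedAddCommGroup E₂] [NormedSpace ℝ E₂] [CompleteSpace E₂]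
  [NormedAddCommGroup E₃] [NormedSpace ℝ E₃] [CompleteSpace E₃]

open NormedSpace in
lemma exp_neg_mul_exp (D : E₁ →L[ℝ] E₁) : exp (-D) * exp D = 1 := by
  let _ : NormedAlgebra ℚ (E₁ →L[ℝ] E₁) := NormedAlgebra.restrictScalars ℚ ℝ _
  have h1 := exp_add_of_commute (Commute.neg_left (Commute.refl D))
  rw [neg_add_cancel, exp_zero] at h1
  exact h1.symm

open NormedSpace in
/-- The exponentials of operators which satisfy the Leibniz rule for a bilinear map are compatible
with this map. -/
lemma exp_bilinear (β : E₁ →L[ℝ] E₂ →L[ℝ] E₃) (D₁ : E₁ →L[ℝ] E₁) (D₂ : E₂ →L[ℝ] E₂)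
    (D₃ : E₃ →L[ℝ] E₃) (hD : ∀ x y, D₃ (β x y) = β (D₁ x) y + β x (D₂ y)) (x : E₁) (y : E₂) :
    exp D₃ (β x y) = β (exp D₁ x) (exp D₂ y) := by
  -- The curve `exp (-s D₃) (β (exp (s D₁) x) (exp (s D₂) y))` has zero derivative; its values at 1
  -- and 0 are then compared.
  have hd : ∀ s : ℝ, HasDerivAt
      (fun s : ℝ => exp (s • (-D₃)) (β (exp (s • D₁) x) (exp (s • D₂) y))) 0 s := by
    intro s
    have h1 : HasDerivAt (fun s : ℝ => exp (s • D₁) x) (D₁ (exp (s • D₁) x)) s := by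
      have := (hasDerivAt_exp_smul_const' (𝕂 := ℝ) D₁ s).clm_apply (hasDerivAt_const s x)
      exact this.congr_deriv (by simp)
    have h2 : HasDerivAt (fun s : ℝ => exp (s • D₂) y) (D₂ (exp (s • D₂) y)) s := by
      have := (hasDerivAt_exp_smul_const' (𝕂 := ℝ) D₂ s).clm_apply (hasDerivAt_const s y)
      exact this.congr_deriv (by simp)
    have h3 := (hasDerivAt_exp_smul_const (𝕂 := ℝ) (-D₃) s).clm_apply
      (β.hasDerivAt_of_bilinear (fun _ => h1) (fun _ => h2))
    refine h3.congr_deriv ?_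
    simp only [mul_apply_eq_comp, neg_apply, map_neg, hD, map_add]
    abel
  have hc := is_const_of_deriv_eq_zero (fun s => (hd s).differentiableAt)
    (fun s => (hd s).deriv) 1 0
  simp only [one_smul, zero_smul, exp_zero, one_apply_eq_self] at hc
  have h1 := exp_neg_mul_exp (-D₃)
  rw [neg_neg] at h1
  rw [← hc, ← mul_apply_eq_comp, h1, one_apply_eq_self]

open NormedSpace in
lemma exp_apply_eq_self {D : E₁ →L[ℝ] E₁} {x : E₁} (hx : D x = 0) : exp D x = x := by
  -- Here the bilinear map is `(a, b) ↦ a b x` on scalars, on which the zero operators act.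
  have := exp_bilinear
    (ContinuousLinearMap.smulRight (1 : ℝ →L[ℝ] ℝ) (ContinuousLinearMap.smulRight
      (1 : ℝ →L[ℝ] ℝ) x)) 0 0 D (fun a b => by simp [hx]) 1 1
  simpa using this

end Exponential

/-! ### Smooth local sections from the inverse function theorem. -/

section LocalInverse

variable {E : Type*} [NormedAddCommGroup E] [NormedSpace ℝ E] [CompleteSpace E]

lemma exists_smooth_local_section {Θ : E → E} {a : E} (hΘ : ContDiffAt ℝ ω Θ a)
    (hd : HasFDerivAt Θ (ContinuousLinearMap.id ℝ E) a) :
    ∃ (N : Set E) (v : E → E), IsOpen N ∧ Θ a ∈ N ∧ ContDiffOn ℝ ∞ v N ∧ ∀ c ∈ N, Θ (v c) = c := by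
  have hd' : HasFDerivAt Θ ((ContinuousLinearEquiv.refl ℝ E : E ≃L[ℝ] E) : E →L[ℝ] E) a := hd
  have hn : (ω : WithTop ℕ∞) ≠ 0 := by simp
  -- Regularity `ω` at a point spreads to a neighbourhood, which `ContDiffAt ℝ ∞` at a single point
  -- would not.
  have h1 := (hΘ.to_localInverse hd' hn).eventually (by simp)
  have h2 := (hΘ.hasStrictFDerivAt' hd' hn).eventually_right_inverse
  obtain ⟨N, hN, hNo, hNa⟩ := mem_nhds_iff.1 (h1.and h2)
  exact ⟨N, _, hNo, hNa, fun c hc => ((hN hc).1.of_le le_top).contDiffWithinAt,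
    fun c hc => (hN hc).2⟩

end LocalInverse

lemma ShortGrading.weight_neg {g : Type*} [LieRing g] [LieAlgebra ℝ g] {ι : Type*}
    {B : LinearMap.BilinForm ℝ g} {t : Module.Basis ι ℝ g} {deg : ι → ℤ} {h : g}
    (hG : ShortGrading B t deg h) (a : ι) (ha : deg a < 0) :
    t a ∈ gr h (-1) := by
  have : deg a = -1 := by rcases hG.deg_mem a with h | h | h <;> omega
  exact this ▸ hG.weight a

/-! ### Automorphisms `exp (ad z)` and a local smooth choice of the conjugation. -/

section Section

variable {g : Type*} [LieRing g] [LieAlgebra ℝ g] {ι : Type*} [Fintype ι]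
variable {B : LinearMap.BilinForm ℝ g} {t : Module.Basis ι ℝ g} {deg : ι → ℤ} {h : g}

/-- A linear endomorphism in the coordinates of a basis. -/
noncomputable def coordMap (t : Module.Basis ι ℝ g) :
    (g →ₗ[ℝ] g) →ₗ[ℝ] ((ι → ℝ) →L[ℝ] (ι → ℝ)) :=
  (LinearMap.toContinuousLinearMap : ((ι → ℝ) →ₗ[ℝ] (ι → ℝ)) ≃ₗ[ℝ] _).toLinearMap ∘ₗ
    (t.equivFun.conj : (g →ₗ[ℝ] g) ≃ₗ[ℝ] _).toLinearMap

lemma coordMap_apply (T : g →ₗ[ℝ] g) (x : ι → ℝ) :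
    coordMap t T x = t.equivFun (T (t.equivFun.symm x)) := rfl

open NormedSpace in
lemma exp_coordMap_lie (z x y : g) :
    t.equivFun.symm (exp (coordMap t (LieAlgebra.ad ℝ g z)) (t.equivFun ⁅x, y⁆)) =
      ⁅t.equivFun.symm (exp (coordMap t (LieAlgebra.ad ℝ g z)) (t.equivFun x)),
        t.equivFun.symm (exp (coordMap t (LieAlgebra.ad ℝ g z)) (t.equivFun y))⁆ := by
  let b : (ι → ℝ) →ₗ[ℝ] (ι → ℝ) →ₗ[ℝ] (ι → ℝ) :=
    LinearMap.mk₂ ℝ (fun u v => t.equivFun ⁅t.equivFun.symm u, t.equivFun.symm v⁆)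
      (by intros; simp only [map_add, add_lie]) (by intros; simp only [map_smul, smul_lie])
      (by intros; simp only [map_add, lie_add]) (by intros; simp only [map_smul, lie_smul])
  let β : (ι → ℝ) →L[ℝ] (ι → ℝ) →L[ℝ] (ι → ℝ) := LinearMap.toContinuousLinearMap
    ((LinearMap.toContinuousLinearMap : ((ι → ℝ) →ₗ[ℝ] (ι → ℝ)) ≃ₗ[ℝ] _).toLinearMap ∘ₗ b)
  have hβ : ∀ u v, β u v = t.equivFun ⁅t.equivFun.symm u, t.equivFun.symm v⁆ := fun _ _ => rfl
  have := exp_bilinear β (coordMap t (LieAlgebra.ad ℝ g z)) (coordMap t (LieAlgebra.ad ℝ g z))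
    (coordMap t (LieAlgebra.ad ℝ g z)) (fun u v => by
      simp only [hβ, coordMap_apply, LinearEquiv.symm_apply_apply, LieAlgebra.ad_apply,
        leibniz_lie z, map_add]) (t.equivFun x) (t.equivFun y)
  simp only [hβ, LinearEquiv.symm_apply_apply] at this
  rw [this, LinearEquiv.symm_apply_apply]

/-- The automorphism `exp (ad z)`. -/
noncomputable def expAut (t : Module.Basis ι ℝ g) (z : g) : g ≃ₗ⁅ℝ⁆ g where
  toFun x := t.equivFun.symm
    (NormedSpace.exp (coordMap t (LieAlgebra.ad ℝ g z)) (t.equivFun x))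
  invFun x := t.equivFun.symm
    (NormedSpace.exp (-coordMap t (LieAlgebra.ad ℝ g z)) (t.equivFun x))
  map_add' a b := by simp only [map_add]
  map_smul' r a := by simp only [map_smul, RingHom.id_apply]
  map_lie' {a b} := exp_coordMap_lie z a b
  left_inv x := by
    simp only [LinearEquiv.apply_symm_apply]
    rw [← mul_apply_eq_comp, exp_neg_mul_exp, one_apply_eq_self, LinearEquiv.symm_apply_apply]
  right_inv x := by
    simp only [LinearEquiv.apply_symm_apply]
    have h1 := exp_neg_mul_exp (-coordMap t (LieAlgebra.ad ℝ g z))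
    rw [neg_neg] at h1
    rw [← mul_apply_eq_comp, h1, one_apply_eq_self, LinearEquiv.symm_apply_apply]

lemma expAut_apply (z x : g) : expAut t z x = t.equivFun.symm
    (NormedSpace.exp (coordMap t (LieAlgebra.ad ℝ g z)) (t.equivFun x)) := rfl

lemma expAut_symm_apply (z x : g) : (expAut t z).symm x = t.equivFun.symm
    (NormedSpace.exp (-coordMap t (LieAlgebra.ad ℝ g z)) (t.equivFun x)) := rfl

/-- Invariance of `B` is the Leibniz rule for `ad z`, `ad z` and the zero operator on scalars. -/
lemma form_expAut (invariant : ∀ x y z, B ⁅x, y⁆ z = B x ⁅y, z⁆) (z x y : g) :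
    B (expAut t z x) (expAut t z y) = B x y := by
  let b : (ι → ℝ) →ₗ[ℝ] (ι → ℝ) →ₗ[ℝ] ℝ :=
    B.compl₁₂ t.equivFun.symm.toLinearMap t.equivFun.symm.toLinearMap
  let β : (ι → ℝ) →L[ℝ] (ι → ℝ) →L[ℝ] ℝ := LinearMap.toContinuousLinearMap
    ((LinearMap.toContinuousLinearMap : ((ι → ℝ) →ₗ[ℝ] ℝ) ≃ₗ[ℝ] _).toLinearMap ∘ₗ b)
  have hβ : ∀ u v, β u v = B (t.equivFun.symm u) (t.equivFun.symm v) := fun _ _ => rfl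
  have := exp_bilinear β (coordMap t (LieAlgebra.ad ℝ g z)) (coordMap t (LieAlgebra.ad ℝ g z))
    0 (fun u v => by
      simp only [hβ, coordMap_apply, LinearEquiv.symm_apply_apply, LieAlgebra.ad_apply,
        zero_apply]
      rw [← lie_skew, map_neg, LinearMap.neg_apply, invariant, neg_add_cancel])
    (t.equivFun x) (t.equivFun y)
  simp only [hβ, LinearEquiv.symm_apply_apply, NormedSpace.exp_zero,
    one_apply_eq_self] at this
  exact this.symm

lemma expAut_eq_self {z x : g} (hzx : ⁅z, x⁆ = 0) : expAut t z x = x := by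
  rw [expAut_apply, exp_apply_eq_self, LinearEquiv.symm_apply_apply]
  simp [coordMap_apply, hzx]

lemma negElt_mem (hw : ∀ a, deg a < 0 → t a ∈ gr h (-1)) (c : NegIdx deg → ℝ) :
    negElt t deg c ∈ gr h (-1) :=
  Submodule.sum_mem _ fun α _ => Submodule.smul_mem _ _ (hw α α.2)

lemma ShortGrading.negElt_negCoord_equivFun (hG : ShortGrading B t deg h) {X : g}
    (hX : X ∈ gr h (-1)) : negElt t deg (negCoord deg (t.equivFun X)) = X := by
  rw [hG.negElt_negCoord, total_eq, LinearEquiv.symm_apply_apply, part_of_mem hG.weight hX]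

lemma negCoord_equivFun_negElt (c : NegIdx deg → ℝ) :
    negCoord deg (t.equivFun (negElt t deg c)) = c := by
  classical
  funext α
  simp only [negCoord, negElt, Module.Basis.equivFun_apply, map_sum, map_smul,
    Module.Basis.repr_self]
  rw [Finset.sum_apply]
  rw [Finset.sum_eq_single α]
  · simp
  · intro b _ hb
    have : (b : ι) ≠ α := fun hab => hb (Subtype.ext hab)
    simp [this]
  · simp

lemma IsGradedConj.map_triple {e f : g} {c : NegIdx deg → ℝ} {ψ : g ≃ₗ⁅ℝ⁆ g}
    (hψ : IsGradedConj B t deg h f c ψ) (ht : IsSl2Triple h e f) :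
    IsSl2Triple h (ψ e) (negElt t deg c) where
  h_ne_zero := ht.h_ne_zero
  lie_e_f := by rw [← hψ.map_f, ← LieEquiv.map_lie, ht.lie_e_f, hψ.map_h]
  lie_h_e_nsmul := by
    conv_lhs => rw [← hψ.map_h, ← LieEquiv.map_lie, ht.lie_h_e_nsmul, map_nsmul]
  lie_h_f_nsmul := by
    conv_lhs => rw [← hψ.map_f, ← hψ.map_h, ← LieEquiv.map_lie, ht.lie_h_f_nsmul, map_neg,
      map_nsmul, hψ.map_f]

/-- Near a point of the regular set, the conjugating automorphisms can be chosen so that they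
depend smoothly on the point. -/
lemma exists_smooth_gradedConj (hG : ShortGrading B t deg h) {e f : g}
    (ht : IsSl2Triple h e f) {c₁ : NegIdx deg → ℝ} (hc₁ : c₁ ∈ regularSet B t deg h f) :
    ∃ (N : Set (NegIdx deg → ℝ)) (T : (NegIdx deg → ℝ) → (ι → ℝ) →L[ℝ] (ι → ℝ)),
      IsOpen N ∧ c₁ ∈ N ∧ ContDiffOn ℝ ∞ T N ∧ ∀ c ∈ N, ∃ ψ : g ≃ₗ⁅ℝ⁆ g,
        IsGradedConj B t deg h f c ψ ∧ ∀ x, t.equivFun (ψ.symm (total t x)) = T c x := by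
  obtain ⟨ψ₁, hψ₁⟩ := hc₁
  have ht₁ := hψ₁.map_triple ht
  have hmem := negElt_mem hG.weight_neg
  let negL : (NegIdx deg → ℝ) →ₗ[ℝ] g := Fintype.linearCombination ℝ fun α => t α
  have hnegL : ∀ v, negL v = negElt t deg v := fun v => rfl
  -- A right inverse of `g_0 → g_{-1}`, `z ↦ ⁅z, c₁⁆`: the factor `-½` makes `⁅z v, c₁⁆ = v`, so `Θ`
  -- below has derivative the identity at 0.
  let z : (NegIdx deg → ℝ) →ₗ[ℝ] g :=
    (-2⁻¹ : ℝ) • ((LieAlgebra.ad ℝ g (ψ₁ e) : g →ₗ[ℝ] g) ∘ₗ negL)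
  have hz : ∀ v, z v = (-2⁻¹ : ℝ) • ⁅ψ₁ e, negElt t deg v⁆ := fun v => rfl
  have hzmem : ∀ v, z v ∈ gr h 0 := fun v => by
    rw [hz]
    exact Submodule.smul_mem _ _ (lie_mem_gr (triple_mem ht₁).1 (hmem v) (by norm_num))
  have hzh : ∀ v, ⁅z v, h⁆ = 0 := fun v => by
    rw [← lie_skew, mem_gr.1 (hzmem v)]; simp
  have hzc : ∀ v, ⁅z v, negElt t deg c₁⁆ = negElt t deg v := by
    intro v
    have h1 : ⁅⁅ψ₁ e, negElt t deg v⁆, negElt t deg c₁⁆ = (-2 : ℝ) • negElt t deg v := by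
      rw [lie_lie, hG.lie_neg_eq_zero (hmem v) (hmem c₁), lie_zero, zero_sub, ht₁.lie_e_f,
        lie_skew, mem_gr.1 (hmem v)]
      norm_num
    rw [hz, smul_lie, h1, smul_smul]
    norm_num
  let D : (NegIdx deg → ℝ) →L[ℝ] ((ι → ℝ) →L[ℝ] (ι → ℝ)) := LinearMap.toContinuousLinearMap
    (coordMap t ∘ₗ (LieAlgebra.ad ℝ g : g →ₗ[ℝ] _) ∘ₗ z)
  have hD : ∀ v, D v = coordMap t (LieAlgebra.ad ℝ g (z v)) := fun v => rfl
  let pr : (ι → ℝ) →L[ℝ] (NegIdx deg → ℝ) :=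
    ContinuousLinearMap.pi fun α => ContinuousLinearMap.proj (α : ι)
  have hpr : ∀ x, pr x = negCoord deg x := fun x => rfl
  let x₁ : ι → ℝ := t.equivFun (negElt t deg c₁)
  let Θ : (NegIdx deg → ℝ) → (NegIdx deg → ℝ) := fun v => pr (NormedSpace.exp (D v) x₁)
  have hexp : ContDiff ℝ ω (NormedSpace.exp : ((ι → ℝ) →L[ℝ] (ι → ℝ)) → _) :=
    contDiff_iff_contDiffAt.2 fun x => (NormedSpace.exp_analytic x).contDiffAt
  have hΘ : ContDiff ℝ ω Θ :=
    pr.contDiff.comp ((hexp.comp D.contDiff).clm_apply contDiff_const)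
  have hΘd : HasFDerivAt Θ (ContinuousLinearMap.id ℝ _) 0 := by
    have h0 : HasFDerivAt (NormedSpace.exp : ((ι → ℝ) →L[ℝ] (ι → ℝ)) → _)
        (1 : ((ι → ℝ) →L[ℝ] (ι → ℝ)) →L[ℝ] _) (D 0) := by
      rw [map_zero]; exact hasFDerivAt_exp_zero
    have h1 := pr.hasFDerivAt.comp (0 : NegIdx deg → ℝ)
      ((h0.comp (0 : NegIdx deg → ℝ) D.hasFDerivAt).clm_apply
        (hasFDerivAt_const x₁ (0 : NegIdx deg → ℝ)))
    refine h1.congr_fderiv ?_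
    refine ContinuousLinearMap.ext fun v => ?_
    have h2 : pr (D v x₁) = v := by
      rw [hD, coordMap_apply]
      simp only [x₁, LinearEquiv.symm_apply_apply]
      show negCoord deg (t.equivFun ⁅z v, negElt t deg c₁⁆) = v
      rw [hzc, negCoord_equivFun_negElt]
    simpa using h2
  obtain ⟨N, v, hN, hNc, hv, hΘv⟩ := exists_smooth_local_section hΘ.contDiffAt hΘd
  have hΘ0 : Θ 0 = c₁ := by
    show pr (NormedSpace.exp (D 0) x₁) = c₁
    rw [map_zero, NormedSpace.exp_zero]
    exact negCoord_equivFun_negElt c₁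
  rw [hΘ0] at hNc
  refine ⟨N, fun c => (coordMap t (ψ₁.symm : g →ₗ⁅ℝ⁆ g)).comp (NormedSpace.exp (-(D (v c)))),
    hN, hNc, ?_, fun c hc => ?_⟩
  · exact contDiffOn_const.clm_comp
      ((hexp.of_le le_top).comp_contDiffOn (D.contDiff.comp_contDiffOn hv).neg)
  · refine ⟨ψ₁.trans (expAut t (z (v c))), ⟨?_, ?_, ?_⟩, fun x => ?_⟩
    · rw [LieEquiv.trans_apply, hψ₁.map_h, expAut_eq_self (hzh _)]
    · intro x y
      rw [LieEquiv.trans_apply, LieEquiv.trans_apply, form_expAut hG.invariant, hψ₁.map_form]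
    · rw [LieEquiv.trans_apply, hψ₁.map_f]
      -- The projection `pr` in `Θ` loses nothing: `z` has degree 0, so its exponential preserves
      -- `g_{-1}`.
      have h1 : expAut t (z (v c)) (negElt t deg c₁) ∈ gr h (-1) := by
        rw [mem_gr]
        conv_lhs => rw [← expAut_eq_self (t := t) (hzh (v c)), ← LieEquiv.map_lie,
          mem_gr.1 (hmem c₁), map_smul]
      rw [← hG.negElt_negCoord_equivFun h1]
      congr 1
      rw [expAut_apply, LinearEquiv.apply_symm_apply]
      exact hΘv c hc
    · rw [total_eq]
      show t.equivFun (ψ₁.symm ((expAut t (z (v c))).symm _)) = _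
      rw [expAut_symm_apply, LinearEquiv.apply_symm_apply]
      rfl

end Section

/-! ### Patching local choices on a dense open set. -/

section Glue

open Topology

variable {E Y : Type*} [TopologicalSpace E]

/-- A local property of functions which is satisfied near each point of `V` by some function is
satisfied by one function on a dense open subset. -/
lemma exists_dense_glue [Nonempty Y] {Q : (E → Y) → E → Prop}
    (hQ : ∀ F F' c, F' =ᶠ[𝓝 c] F → Q F c → Q F' c) {V : Set E} (hV : IsOpen V)
    (hloc : ∀ c ∈ V, ∃ N : Set E, IsOpen N ∧ c ∈ N ∧ ∃ F : E → Y, ∀ c' ∈ N, Q F c') :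
    ∃ U : Set E, IsOpen U ∧ U ⊆ V ∧ V ⊆ closure U ∧ ∃ F : E → Y, ∀ c ∈ U, Q F c := by
  classical
  choose N hN hcN F hF using fun c : V => hloc c c.2
  obtain ⟨lo, hlo⟩ := exists_wellFoundedLT V
  -- Well-order the patches and remove from each the closure of the union of the earlier ones. The
  -- pieces are open and disjoint, so the choices cannot conflict.
  let U : V → Set E := fun v => (N v ∩ V) \ closure (⋃ w : Set.Iio v, N w)
  have hUopen : ∀ v, IsOpen (U v) := fun v => ((hN v).inter hV).sdiff isClosed_closure
  have huniq : ∀ v w c, c ∈ U v → c ∈ U w → v = w := by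
    have key : ∀ v w c, c ∈ U v → c ∈ U w → ¬ v < w := fun v w c hv hw hlt =>
      hw.2 (subset_closure (Set.mem_iUnion.2 ⟨⟨v, hlt⟩, hv.1.1⟩))
    intro v w c hv hw
    exact le_antisymm (not_lt.1 (key w v c hw hv)) (not_lt.1 (key v w c hv hw))
  refine ⟨⋃ v, U v, isOpen_iUnion hUopen, Set.iUnion_subset fun v c hc => hc.1.2, ?_,
    fun c => if hc : ∃ v, c ∈ U v then F hc.choose c else Classical.arbitrary Y, ?_⟩
  · intro c hc
    rw [mem_closure_iff]
    intro T hT hcT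
    let S : Set V := {v | (T ∩ (N v ∩ V)).Nonempty}
    have hS : S.Nonempty := ⟨⟨c, hc⟩, c, hcT, hcN ⟨c, hc⟩, hc⟩
    -- Density: take the first patch that meets the test set `T` inside `V`. If its point `p` lay in
    -- the removed closure, an earlier patch would meet `T ∩ V`.
    obtain ⟨p, hpT, hpN⟩ := hlo.wf.min_mem S hS
    refine ⟨p, hpT, Set.mem_iUnion.2 ⟨hlo.wf.min S hS, hpN, fun hp => ?_⟩⟩
    obtain ⟨q, ⟨hqT, hqV⟩, hq⟩ := mem_closure_iff.1 hp (T ∩ V) (hT.inter hV) ⟨hpT, hpN.2⟩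
    obtain ⟨⟨w, hw⟩, hqw⟩ := Set.mem_iUnion.1 hq
    exact hlo.wf.not_lt_min S (x := w) ⟨q, hqT, hqw, hqV⟩ hw
  · intro c hc
    obtain ⟨v, hv⟩ := Set.mem_iUnion.1 hc
    refine hQ (F v) _ c ?_ (hF v c hv.1.1)
    filter_upwards [(hUopen v).mem_nhds hv] with c' hc'
    have hex : ∃ v, c' ∈ U v := ⟨v, hc'⟩
    rw [dif_pos hex, huniq _ _ c' hex.choose_spec hc']

/-- To retain the prescribed point, keep one whole patch around it and glue only on the complement
of its closure. -/
lemma exists_dense_glue_mem [Nonempty Y] {Q : (E → Y) → E → Prop}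
    (hQ : ∀ F F' c, F' =ᶠ[𝓝 c] F → Q F c → Q F' c) {V : Set E} (hV : IsOpen V)
    (hloc : ∀ c ∈ V, ∃ N : Set E, IsOpen N ∧ c ∈ N ∧ ∃ F : E → Y, ∀ c' ∈ N, Q F c')
    {c₀ : E} (hc₀ : c₀ ∈ V) :
    ∃ U : Set E, IsOpen U ∧ c₀ ∈ U ∧ U ⊆ V ∧ V ⊆ closure U ∧ ∃ F : E → Y, ∀ c ∈ U, Q F c := by
  classical
  obtain ⟨N, hN, hcN, F, hF⟩ := hloc c₀ hc₀
  obtain ⟨U, hU, hUV, hVU, F', hF'⟩ := exists_dense_glue hQ (V := V \ closure (N ∩ V))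
    (hV.sdiff isClosed_closure) (fun c hc => hloc c hc.1)
  refine ⟨(N ∩ V) ∪ U, (hN.inter hV).union hU, Or.inl ⟨hcN, hc₀⟩,
    Set.union_subset Set.inter_subset_right fun c hc => (hUV hc).1, fun c hc => ?_,
    fun c => if c ∈ N ∩ V then F c else F' c, ?_⟩
  · rw [closure_union]
    by_cases h : c ∈ closure (N ∩ V)
    · exact Or.inl h
    · exact Or.inr (hVU ⟨hc, h⟩)
  · rintro c (hc | hc)
    · refine hQ F _ c ?_ (hF c hc.1)
      filter_upwards [(hN.inter hV).mem_nhds hc] with c' hc'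
      rw [if_pos hc']
    · refine hQ F' _ c ?_ (hF' c hc)
      filter_upwards [hU.mem_nhds hc] with c' hc'
      rw [if_neg fun h => (hUV hc').2 (subset_closure h)]

end Glue

/-! ### Smoothness of determinants, inverse matrices and polynomial values. -/

section MatrixSmooth

variable {E : Type*} [NormedAddCommGroup E] [NormedSpace ℝ E] {κ : Type*} [Fintype κ]
  [DecidableEq κ]

lemma contDiffAt_det {M : E → Matrix κ κ ℝ} {c : E}
    (hM : ∀ s r, ContDiffAt ℝ ∞ (fun x => M x s r) c) :
    ContDiffAt ℝ ∞ (fun x => (M x).det) c := by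
  simp only [Matrix.det_apply']
  exact ContDiffAt.sum fun τ _ => contDiffAt_const.mul (contDiffAt_prod fun i _ => hM _ _)

lemma contDiffAt_inv {M : E → Matrix κ κ ℝ} {c : E}
    (hM : ∀ s r, ContDiffAt ℝ ∞ (fun x => M x s r) c) (hu : IsUnit (M c)) (s r : κ) :
    ContDiffAt ℝ ∞ (fun x => (M x)⁻¹ s r) c := by
  simp only [Matrix.inv_def, Matrix.smul_apply, smul_eq_mul, Ring.inverse_eq_inv',
    Matrix.adjugate_apply]
  refine ((contDiffAt_det hM).inv ((Matrix.isUnit_iff_isUnit_det _).1 hu).ne_zero).mul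
    (contDiffAt_det fun i j => ?_)
  simp only [Matrix.updateRow_apply]
  split_ifs
  · exact contDiffAt_const
  · exact hM i j

lemma contDiffAt_eval {ν : Type*} [Fintype ν] {v : E → ν → ℝ} {c : E}
    (hv : ∀ a, ContDiffAt ℝ ∞ (fun x => v x a) c) (p : MvPolynomial ν ℝ) :
    ContDiffAt ℝ ∞ (fun x => MvPolynomial.eval (v x) p) c := by
  have h1 : ContDiffAt ℝ ∞ (fun z : ν → ℝ => MvPolynomial.eval z p) (v c) :=
    (AnalyticOnNhd.eval_mvPolynomial p (v c) (Set.mem_univ _)).contDiffAt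
  exact h1.comp c (contDiffAt_pi.2 hv)

end MatrixSmooth

/-! ### Comparing the enlarged algebra with the finite W-algebra fibre by fibre. -/

section Enlarged

variable {g : Type*} [LieRing g] [LieAlgebra ℝ g] {ι : Type*} [Fintype ι]
  {κ : Type*} [Fintype κ]
variable {B : LinearMap.BilinForm ℝ g} {t : Module.Basis ι ℝ g} {deg : ι → ℤ} {h e f : g}
  {σ : κ → ℤ} {ℓ : κ → g} {L : g →ₗ[ℝ] (κ → ℝ)} {W : κ → wAlgebra t deg f}
  {V U : Set (NegIdx deg → ℝ)} {ℓt : κ → (NegIdx deg → ℝ) → g}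

/-- A short grading with an `sl₂` triple, a basis of highest weight vectors, coordinates `L` with
respect to this basis, and the corresponding generators of the W-algebra. -/
structure SliceData (B : LinearMap.BilinForm ℝ g) (t : Module.Basis ι ℝ g) (deg : ι → ℤ)
    (h e f : g) (σ : κ → ℤ) (ℓ : κ → g) (L : g →ₗ[ℝ] (κ → ℝ)) (W : κ → wAlgebra t deg f) :
    Prop where
  grading : ShortGrading B t deg h
  triple : IsSl2Triple h e f
  basis : IsHighestWeightBasis h e σ ℓ
  coord_sum : ∀ w : κ → ℝ, L (∑ s, w s • ℓ s) = w
  sum_coord : ∀ z : g, ⁅e, z⁆ = 0 → ∑ s, L z s • ℓ s = z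
  gen : IsSliceGenerators t deg e f ℓ W

lemma total_equivFun (t : Module.Basis ι ℝ g) (X : g) : total t (t.equivFun X) = X := by
  rw [total_eq, LinearEquiv.symm_apply_apply]

lemma part_map (hG : ShortGrading B t deg h) (φ : g →ₗ[ℝ] g)
    (hφ : ∀ k, ∀ x ∈ gr h k, φ x ∈ gr h k) (x : g) :
    part t deg (-1) (φ x) = φ (part t deg (-1) x) := by
  have hm : ∀ k, φ (part t deg k x) ∈ gr h k := fun k => hφ k _ (part_mem hG.weight _ _)
  conv_lhs => rw [← hG.sum_part x, map_add, map_add, map_add, map_add]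
  rw [part_of_mem hG.weight (hm (-1)), part_of_mem_ne hG.weight (hm 0) (by norm_num),
    part_of_mem_ne hG.weight (hm 1) (by norm_num), add_zero, add_zero]

lemma negCoord_eq_of_part_eq (hG : ShortGrading B t deg h) {X : g} {c : NegIdx deg → ℝ}
    (hX : part t deg (-1) X = negElt t deg c) : negCoord deg (t.equivFun X) = c := by
  have h1 := hG.negElt_negCoord (t.equivFun X)
  rw [total_equivFun, hX] at h1
  have h2 := congrArg (fun z => negCoord deg (t.equivFun z)) h1
  simpa only [negCoord_equivFun_negElt] using h2

lemma IsGradedConj.symm_mem {c : NegIdx deg → ℝ} {ψ : g ≃ₗ⁅ℝ⁆ g}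
    (hψ : IsGradedConj B t deg h f c ψ) {k : ℤ} {x : g} (hx : x ∈ gr h k) :
    ψ.symm x ∈ gr h k := by
  have h1 : ψ.symm h = h := by
    conv_lhs => rw [← hψ.map_h]
    exact ψ.symm_apply_apply h
  rw [mem_gr]
  conv_lhs => rw [← h1, ← LieEquiv.map_lie, mem_gr.1 hx, map_smul]

lemma IsGradedConj.part_symm (hG : ShortGrading B t deg h) {c : NegIdx deg → ℝ} {ψ : g ≃ₗ⁅ℝ⁆ g}
    (hψ : IsGradedConj B t deg h f c ψ) {x : ι → ℝ} (hx : negCoord deg x = c) :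
    part t deg (-1) (ψ.symm (total t x)) = f := by
  refine (part_map hG (ψ.symm : g →ₗ⁅ℝ⁆ g) (fun k x => hψ.symm_mem) _).trans ?_
  rw [← hG.negElt_negCoord, hx, ← hψ.map_f]
  exact ψ.symm_apply_apply f

lemma IsGradedConj.symm_expAd (hG : ShortGrading B t deg h) {c : NegIdx deg → ℝ}
    {ψ : g ≃ₗ⁅ℝ⁆ g} (hψ : IsGradedConj B t deg h f c ψ) {y : g} (hy : y ∈ gr h 1) (x : g) :
    ψ.symm (expAd y x) = expAd (ψ.symm y) (ψ.symm x) := by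
  rw [hG.expAd_eq hy, hG.expAd_eq (hψ.symm_mem hy)]
  simp only [map_add, map_smul, LieEquiv.map_lie]

/-- The highest weight vectors of the enlarged algebra, conjugated back, in terms of the fixed
ones. -/
def IsConjFrame (B : LinearMap.BilinForm ℝ g) (t : Module.Basis ι ℝ g) (deg : ι → ℤ) (h f : g)
    (L : g →ₗ[ℝ] (κ → ℝ)) (ℓt : κ → (NegIdx deg → ℝ) → g) (c : NegIdx deg → ℝ)
    (ψ : g ≃ₗ⁅ℝ⁆ g) (M : Matrix κ κ ℝ) : Prop :=
  IsGradedConj B t deg h f c ψ ∧ ∀ s r, M s r = L (ψ.symm (ℓt r c)) s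

omit [Fintype κ] in
/-- The frame matrix is smooth for a smooth choice of the conjugating automorphisms. -/
lemma contDiffAt_frame (hℓt : IsHighestWeightFrame t deg h σ V ℓt) (hV : IsOpen V)
    {N : Set (NegIdx deg → ℝ)} (hN : IsOpen N)
    {T : (NegIdx deg → ℝ) → (ι → ℝ) →L[ℝ] (ι → ℝ)} (hT : ContDiffOn ℝ ∞ T N)
    {c : NegIdx deg → ℝ} (hcN : c ∈ N) (hcV : c ∈ V) (L : g →ₗ[ℝ] (κ → ℝ)) (s r : κ) :
    ContDiffAt ℝ ∞ (fun c => L (t.equivFun.symm (T c (t.equivFun (ℓt r c)))) s) c := by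
  let L' : (ι → ℝ) →L[ℝ] ℝ := LinearMap.toContinuousLinearMap
    (LinearMap.proj s ∘ₗ L ∘ₗ t.equivFun.symm.toLinearMap)
  exact L'.contDiff.contDiffAt.comp c ((hT.contDiffAt (hN.mem_nhds hcN)).clm_apply
    ((hℓt.smooth r).contDiffAt (hV.mem_nhds hcV)))

omit [Fintype κ] in
lemma isConjFrame_of_eq {c : NegIdx deg → ℝ} {ψ : g ≃ₗ⁅ℝ⁆ g}
    (hψ : IsGradedConj B t deg h f c ψ) {T : (ι → ℝ) →L[ℝ] (ι → ℝ)}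
    (hT : ∀ x, t.equivFun (ψ.symm (total t x)) = T x) (L : g →ₗ[ℝ] (κ → ℝ)) :
    IsConjFrame B t deg h f L ℓt c ψ
      (Matrix.of fun s r => L (t.equivFun.symm (T (t.equivFun (ℓt r c)))) s) := by
  refine ⟨hψ, fun s r => ?_⟩
  rw [Matrix.of_apply, ← hT, total_eq, LinearEquiv.symm_apply_apply, LinearEquiv.symm_apply_apply]

namespace SliceData

/-- By `triple_unique` the raising element over `c` must be `ψ e`, so `ψ⁻¹` carries its highest
weight vectors into `ker (ad e)`. -/
lemma lie_symm_frame (hS : SliceData B t deg h e f σ ℓ L W)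
    (hℓt : IsHighestWeightFrame t deg h σ V ℓt) {c : NegIdx deg → ℝ} (hc : c ∈ V)
    {ψ : g ≃ₗ⁅ℝ⁆ g} (hψ : IsGradedConj B t deg h f c ψ) (r : κ) : ⁅e, ψ.symm (ℓt r c)⁆ = 0 := by
  obtain ⟨e', ht', hb⟩ := hℓt.basis c hc
  have he' := hS.grading.triple_unique (hψ.map_triple hS.triple) ht'
  have h1 := hb.lie_eq_zero r
  rw [he'] at h1
  have h2 : ψ.symm ⁅ψ e, ℓt r c⁆ = 0 := by rw [h1, map_zero]
  rwa [LieEquiv.map_lie, LieEquiv.symm_apply_apply] at h2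

lemma sum_frame (hS : SliceData B t deg h e f σ ℓ L W)
    (hℓt : IsHighestWeightFrame t deg h σ V ℓt) {c : NegIdx deg → ℝ} (hc : c ∈ V)
    {ψ : g ≃ₗ⁅ℝ⁆ g} {M : Matrix κ κ ℝ} (hψ : IsConjFrame B t deg h f L ℓt c ψ M) (r : κ) :
    ∑ s, M s r • ℓ s = ψ.symm (ℓt r c) := by
  rw [← hS.sum_coord _ (hS.lie_symm_frame hℓt hc hψ.1 r)]
  simp only [hψ.2]

/-- `ψ` fixes `h`, so `ψ⁻¹ ℓ̃^r` keeps its weight and involves only `ℓ^s` of that weight. -/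
lemma frame_eq_zero (hS : SliceData B t deg h e f σ ℓ L W)
    (hℓt : IsHighestWeightFrame t deg h σ V ℓt) {c : NegIdx deg → ℝ} (hc : c ∈ V)
    {ψ : g ≃ₗ⁅ℝ⁆ g} {M : Matrix κ κ ℝ} (hψ : IsConjFrame B t deg h f L ℓt c ψ M) {s r : κ}
    (hsr : σ s ≠ σ r) : M s r = 0 := by
  obtain ⟨e', ht', hb⟩ := hℓt.basis c hc
  have h1 : ψ.symm (ℓt r c) ∈ gr h (σ r) := hψ.1.symm_mem (hb.weight r)
  rw [← hS.sum_frame hℓt hc hψ, mem_gr, lie_sum, Finset.smul_sum] at h1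
  simp only [lie_smul, hS.basis.weight, smul_smul] at h1
  have h2 := congrFun (congrArg L h1) s
  rw [hS.coord_sum (fun s => M s r * (2 * (σ s : ℝ))),
    hS.coord_sum (fun s => 2 * (σ r : ℝ) * M s r)] at h2
  have h3 : ((σ s : ℝ) - σ r) * M s r = 0 := by linarith
  exact (mul_eq_zero.1 h3).resolve_left (sub_ne_zero.2 (by exact_mod_cast hsr))

lemma isUnit_frame [DecidableEq κ] (hS : SliceData B t deg h e f σ ℓ L W)
    (hℓt : IsHighestWeightFrame t deg h σ V ℓt) {c : NegIdx deg → ℝ} (hc : c ∈ V)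
    {ψ : g ≃ₗ⁅ℝ⁆ g} {M : Matrix κ κ ℝ} (hψ : IsConjFrame B t deg h f L ℓt c ψ M) :
    IsUnit M := by
  obtain ⟨e', ht', hb⟩ := hℓt.basis c hc
  rw [← Matrix.mulVec_injective_iff_isUnit]
  refine (injective_iff_map_eq_zero M.mulVecLin).2 fun v hv => ?_
  have h1 : ψ.symm (∑ r, v r • ℓt r c) = 0 := by
    rw [map_sum]
    simp only [map_smul, ← hS.sum_frame hℓt hc hψ, Finset.smul_sum, smul_smul]
    rw [Finset.sum_comm]
    refine Finset.sum_eq_zero fun s _ => ?_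
    have := congrFun hv s
    rw [← Finset.sum_smul]
    simp only [Matrix.mulVecLin_apply, Matrix.mulVec, dotProduct, Pi.zero_apply] at this
    simp only [mul_comm (v _), this, zero_smul]
  have h2 : ∑ r, v r • ℓt r c = 0 := by
    have := congrArg ψ h1
    rwa [LieEquiv.apply_symm_apply, map_zero] at this
  exact funext (Fintype.linearIndependent_iff.1 hb.linearIndependent v h2)

/-- Over `V` the default value in `wTilde` never occurs. -/
lemma exists_wTilde (hS : SliceData B t deg h e f σ ℓ L W)
    (hℓt : IsHighestWeightFrame t deg h σ V ℓt) {x : ι → ℝ} (hx : negCoord deg x ∈ V) :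
    ∃ y ∈ gr h 1, expAd y (total t x) =
      negElt t deg (negCoord deg x) + ∑ s, wTilde t deg ℓt s x • ℓt s (negCoord deg x) := by
  obtain ⟨e', ht', hb⟩ := hℓt.basis _ hx
  obtain ⟨p, hp, -⟩ := hS.grading.existsUnique_highestWeightForm ht' hb
  have hex : ∃ w : κ → ℝ, ∃ y ∈ gPlus t deg, IsHighestWeightForm t deg ℓt x y w :=
    ⟨p.2, p.1, p.1.2, hp⟩
  obtain ⟨y, hy, hw⟩ := hex.choose_spec
  refine ⟨y, hS.grading.gPlus_eq ▸ hy, ?_⟩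
  have hw' : expAd y (total t x) = _ := hw
  rw [hw']
  simp only [wTilde, dif_pos hex]

/-- The generators of the enlarged algebra in terms of those of the W-algebra. -/
lemma eval_gen_eq_sum (hS : SliceData B t deg h e f σ ℓ L W)
    (hℓt : IsHighestWeightFrame t deg h σ V ℓt) {x : ι → ℝ} (hx : negCoord deg x ∈ V)
    {ψ : g ≃ₗ⁅ℝ⁆ g} {M : Matrix κ κ ℝ}
    (hψ : IsConjFrame B t deg h f L ℓt (negCoord deg x) ψ M) (s : κ) :
    MvPolynomial.eval (nonnegCoord t deg (ψ.symm (total t x)))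
      (W s : MvPolynomial (NonnegIdx deg) ℝ) = ∑ r, M s r * wTilde t deg ℓt r x := by
  obtain ⟨y, hy, hw⟩ := hS.exists_wTilde hℓt hx
  have hX := hψ.1.part_symm hS.grading rfl
  have h1 : expAd (ψ.symm y) (ψ.symm (total t x)) - f =
      ∑ r, wTilde t deg ℓt r x • ψ.symm (ℓt r (negCoord deg x)) := by
    rw [← hψ.1.symm_expAd hS.grading hy, hw, map_add, ← hψ.1.map_f, LieEquiv.symm_apply_apply,
      map_sum]
    simp only [map_smul, add_sub_cancel_left]
  -- The transported transformation reaches the highest weight gauge of the original triple, so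
  -- uniqueness identifies its parameter.
  have h2 : ψ.symm y = gaugeParam t deg e (ψ.symm (total t x)) := by
    refine (hS.grading.lie_expAd_sub_eq_zero_iff hS.triple hX (hψ.1.symm_mem hy)).1 ?_
    rw [h1, lie_sum]
    exact Finset.sum_eq_zero fun r _ => by
      rw [lie_smul, hS.lie_symm_frame hℓt hx hψ.1, smul_zero]
  rw [h2, hS.gen _ hX, add_sub_cancel_left] at h1
  have h3 := congrFun (congrArg L h1) s
  rw [hS.coord_sum, map_sum, Finset.sum_apply] at h3
  rw [h3]
  refine Finset.sum_congr rfl fun r _ => ?_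
  rw [map_smul, Pi.smul_apply, smul_eq_mul, hψ.2, mul_comm]

lemma part_slice (hS : SliceData B t deg h e f σ ℓ L W) (w : κ → ℝ) :
    part t deg (-1) (f + ∑ s, w s • ℓ s) = f := by
  obtain ⟨he, hf⟩ := triple_mem hS.triple
  rw [map_add, part_of_mem hS.grading.weight hf, map_sum]
  simp only [map_smul]
  rw [Finset.sum_eq_zero, add_zero]
  intro s _
  have hs : ℓ s ∈ gr h (σ s) := hS.basis.weight s
  by_cases hσ : σ s = -1
  · rw [hσ] at hs
    -- A highest weight vector of degree `-1` is killed by both `e` and `f`, hence by `h = ⁅e, f⁆`,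
    -- hence it is zero.
    have h1 : ⁅h, ℓ s⁆ = 0 := by
      rw [← hS.triple.lie_e_f, lie_lie, hS.grading.lie_neg_eq_zero hf hs,
        hS.basis.lie_eq_zero, lie_zero, lie_zero, sub_zero]
    rw [mem_gr.1 hs] at h1
    rw [(smul_eq_zero.1 h1).resolve_left (by norm_num), map_zero, smul_zero]
  · rw [part_of_mem_ne hS.grading.weight hs (Ne.symm hσ), smul_zero]

/-- A point of the slice is already in the highest weight gauge, so its gauge parameter is 0 and the
`W_s` read off its coordinates. -/
lemma eval_slice (hS : SliceData B t deg h e f σ ℓ L W) (w : κ → ℝ) (s : κ) :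
    MvPolynomial.eval (nonnegCoord t deg (f + ∑ s, w s • ℓ s))
      (W s : MvPolynomial (NonnegIdx deg) ℝ) = w s := by
  have hX := hS.part_slice w
  have h0 : (0 : g) = gaugeParam t deg e (f + ∑ s, w s • ℓ s) := by
    refine (hS.grading.lie_expAd_sub_eq_zero_iff hS.triple hX (Submodule.zero_mem _)).1 ?_
    rw [hS.grading.expAd_zero, add_sub_cancel_left, lie_sum]
    exact Finset.sum_eq_zero fun r _ => by rw [lie_smul, hS.basis.lie_eq_zero, smul_zero]
  have h1 := hS.gen _ hX
  rw [← h0, hS.grading.expAd_zero, add_right_inj] at h1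
  have h2 := congrFun (congrArg L h1) s
  rw [hS.coord_sum, hS.coord_sum] at h2
  exact h2.symm

lemma contDiffAt_negCoord (x : ι → ℝ) : ContDiffAt ℝ ∞ (negCoord deg) x :=
  contDiffAt_pi.2 fun α => (contDiff_apply ℝ ℝ (α : ι)).contDiffAt

/-- The generators of the enlarged algebra are smooth. -/
lemma contDiffAt_wTilde [DecidableEq κ] (hS : SliceData B t deg h e f σ ℓ L W) (hV : IsOpen V)
    (hreg : V ⊆ regularSet B t deg h f) (hℓt : IsHighestWeightFrame t deg h σ V ℓt)
    {x : ι → ℝ} (hx : negCoord deg x ∈ V) (s : κ) :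
    ContDiffAt ℝ ∞ (wTilde t deg ℓt s) x := by
  obtain ⟨N, T, hN, hxN, hT, hNψ⟩ := exists_smooth_gradedConj hS.grading hS.triple (hreg hx)
  let M : (ι → ℝ) → Matrix κ κ ℝ := fun z => Matrix.of fun s r =>
    L (t.equivFun.symm (T (negCoord deg z) (t.equivFun (ℓt r (negCoord deg z))))) s
  have hMs : ∀ s r, ContDiffAt ℝ ∞ (fun z => M z s r) x := fun s r =>
    (contDiffAt_frame hℓt hV hN hT hxN hx L s r).comp x (contDiffAt_negCoord x)
  have hframe : ∀ z, negCoord deg z ∈ N → ∃ ψ : g ≃ₗ⁅ℝ⁆ g,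
      IsConjFrame B t deg h f L ℓt (negCoord deg z) ψ (M z) ∧
        t.equivFun (ψ.symm (total t z)) = T (negCoord deg z) z := by
    intro z hz
    obtain ⟨ψ, hψ, hTψ⟩ := hNψ _ hz
    exact ⟨ψ, isConjFrame_of_eq hψ hTψ L, hTψ z⟩
  let w : (ι → ℝ) → κ → ℝ := fun z r => MvPolynomial.eval
    (fun a : NonnegIdx deg => T (negCoord deg z) z a) (W r : MvPolynomial (NonnegIdx deg) ℝ)
  have hw : ∀ r, ContDiffAt ℝ ∞ (fun z => w z r) x := by
    intro r
    refine contDiffAt_eval (fun a => ?_) _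
    have h1 : ContDiffAt ℝ ∞ (fun z => T (negCoord deg z) z) x :=
      ((hT.contDiffAt (hN.mem_nhds hxN)).comp x (contDiffAt_negCoord x)).clm_apply contDiffAt_id
    exact contDiffAt_pi.1 h1 a
  -- Inverting the frame matrix expresses `W̃` through the polynomials `W_r` at the conjugated
  -- point; every ingredient is smooth near `x`.
  have heq : ∀ z, negCoord deg z ∈ N → negCoord deg z ∈ V →
      wTilde t deg ℓt s z = ∑ r, (M z)⁻¹ s r * w z r := by
    intro z hzN hzV
    obtain ⟨ψ, hψ, hTψ⟩ := hframe z hzN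
    have h1 : w z = (M z).mulVec (fun r => wTilde t deg ℓt r z) := by
      funext r
      have := hS.eval_gen_eq_sum hℓt hzV hψ r
      simp only [w, ← hTψ]
      exact this
    show _ = (M z)⁻¹.mulVec (w z) s
    rw [h1, Matrix.mulVec_mulVec, Matrix.nonsing_inv_mul _
      ((Matrix.isUnit_iff_isUnit_det _).1 (hS.isUnit_frame hℓt hzV hψ)), Matrix.one_mulVec]
  obtain ⟨ψ, hψ, -⟩ := hframe x hxN
  have hsm : ContDiffAt ℝ ∞ (fun z => ∑ r, (M z)⁻¹ s r * w z r) x :=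
    ContDiffAt.sum fun r _ => (contDiffAt_inv hMs (hS.isUnit_frame hℓt hx hψ) s r).mul (hw r)
  refine hsm.congr_of_eventuallyEq ?_
  have hcont := (contDiffAt_negCoord (deg := deg) x).continuousAt
  filter_upwards [hcont.preimage_mem_nhds (hN.mem_nhds hxN),
    hcont.preimage_mem_nhds (hV.mem_nhds hx)] with z h1 h2
  exact heq z h1 h2

/-- The renormalized generators form the finite W-algebra as soon as the matrix of the
renormalization expresses the highest weight vectors, conjugated back at each point, in terms of
the fixed ones. -/
theorem formWAlgebra [DecidableEq ι] [DecidableEq κ] (hS : SliceData B t deg h e f σ ℓ L W)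
    (hV : IsOpen V) (hreg : V ⊆ regularSet B t deg h f)
    (hℓt : IsHighestWeightFrame t deg h σ V ℓt) (hU : IsOpen U) (hUV : U ⊆ V) (hne : U.Nonempty)
    {F : (NegIdx deg → ℝ) → Matrix κ κ ℝ} (hF : ∀ s r, ContDiffOn ℝ ∞ (fun c => F c s r) U)
    (hFψ : ∀ c ∈ U, ∃ ψ : g ≃ₗ⁅ℝ⁆ g, IsConjFrame B t deg h f L ℓt c ψ (F c)) :
    FormWAlgebra B t deg f U W (renormalized t deg ℓt F) := by
  have hG := hS.grading
  have hf := (triple_mem hS.triple).2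
  have hsmooth : ∀ s x, negCoord deg x ∈ U →
      ContDiffAt ℝ ∞ (renormalized t deg ℓt F s) x := fun s x hx =>
    ContDiffAt.sum fun r _ => (((hF s r).contDiffAt (hU.mem_nhds hx)).comp x
      (contDiffAt_negCoord x)).mul (hS.contDiffAt_wTilde hV hreg hℓt (hUV hx) r)
  have hren : ∀ x, negCoord deg x ∈ U → ∀ ψ : g ≃ₗ⁅ℝ⁆ g,
      IsConjFrame B t deg h f L ℓt (negCoord deg x) ψ (F (negCoord deg x)) → ∀ s,
      renormalized t deg ℓt F s x = MvPolynomial.eval (nonnegCoord t deg (ψ.symm (total t x)))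
        (W s : MvPolynomial (NonnegIdx deg) ℝ) := fun x hx ψ hψ s =>
    (hS.eval_gen_eq_sum hℓt (hUV hx) hψ s).symm
  -- Evaluation at the slice point with coordinates `Ŵ_s(x)` is visibly an algebra homomorphism and
  -- involves no choice of `ψ`; `hΦψ` then rewrites it as `p(ψ⁻¹ x)` over `U`.
  let Φ : wAlgebra t deg f →ₐ[ℝ] ((ι → ℝ) → ℝ) := AlgHom.pi fun x =>
    (MvPolynomial.aeval (nonnegCoord t deg
      (f + ∑ s, renormalized t deg ℓt F s x • ℓ s))).comp (wAlgebra t deg f).val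
  have hΦ : ∀ p x, Φ p x = MvPolynomial.eval (nonnegCoord t deg
      (f + ∑ s, renormalized t deg ℓt F s x • ℓ s)) (p : MvPolynomial (NonnegIdx deg) ℝ) :=
    fun p x => rfl
  have hΦW : ∀ s, Φ (W s) = renormalized t deg ℓt F s := fun s => by
    funext x
    rw [hΦ, hS.eval_slice]
  have hΦψ : ∀ x, negCoord deg x ∈ U → ∀ ψ : g ≃ₗ⁅ℝ⁆ g,
      IsConjFrame B t deg h f L ℓt (negCoord deg x) ψ (F (negCoord deg x)) → ∀ p,
      Φ p x = MvPolynomial.eval (nonnegCoord t deg (ψ.symm (total t x)))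
        (p : MvPolynomial (NonnegIdx deg) ℝ) := by
    intro x hx ψ hψ p
    rw [hS.gen.eval_eq hG hS.triple p (hψ.1.part_symm hG rfl), hΦ]
    simp only [hren x hx ψ hψ]
  have hΦs : ∀ p x, negCoord deg x ∈ U → DifferentiableAt ℝ (Φ p) x := by
    intro p x hx
    refine (contDiffAt_eval (v := fun x => nonnegCoord t deg
      (f + ∑ s, renormalized t deg ℓt F s x • ℓ s)) (fun a => ?_) p.1).differentiableAt (by simp)
    simp only [nonnegCoord, map_add, map_sum, map_smul, Finsupp.add_apply, Finset.sum_apply',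
      Finsupp.smul_apply, smul_eq_mul]
    exact contDiffAt_const.add (ContDiffAt.sum fun s _ => (hsmooth s x hx).mul contDiffAt_const)
  have hΦinv : ∀ p x, negCoord deg x ∈ U → ∀ y ∈ gr h 1,
      Φ p (t.equivFun (expAd y (total t x))) = Φ p x := by
    intro p x hx y hy
    have hneg : negCoord deg (t.equivFun (expAd y (total t x))) = negCoord deg x :=
      negCoord_eq_of_part_eq hG (by rw [hG.part_neg_expAd hy, hG.negElt_negCoord])
    obtain ⟨ψ, hψ⟩ := hFψ _ hx
    rw [hΦψ x hx ψ hψ, hΦψ _ (by rwa [hneg]) ψ (by rwa [hneg]), total_equivFun, hψ.1.symm_expAd hG hy]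
    exact (mem_wAlgebra_iff hG hf).1 p.2 _ (hψ.1.symm_mem hy) _ (hψ.1.part_symm hG rfl)
  refine ⟨fun s x hx => (hsmooth s x hx).contDiffWithinAt, fun α s x hx => ?_, Φ, hΦW, ?_, ?_⟩
  -- The gradient of `J_α` lies in `g_1`, so the bracket is an infinitesimal gauge variation of an
  -- invariant function.
  · rw [poisson_eq, ← hΦW]
    refine hG.form_lie_grad_eq_zero (hΦs _ x hx) (hΦinv _ x hx) (hG.mem_gr_one_of_form ?_)
    intro b hb
    rw [hG.form_grad, (hasFDerivAt_apply (α : ι) x).fderiv]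
    have : b ≠ α := by
      rintro rfl
      have := α.2
      rcases hG.deg_mem α with h | h | h <;> omega
    simp [this]
  · intro p hp
    -- A single fibre suffices: `ψ` maps the whole constraint surface into it, so `p` vanishes at
    -- every `u`.
    obtain ⟨c, hc⟩ := hne
    obtain ⟨ψ, hψ⟩ := hFψ c hc
    refine Subtype.ext (MvPolynomial.funext fun u => ?_)
    set X := total t (constrPt t deg f u)
    have hX : part t deg (-1) X = f := part_neg_total_constrPt hG hf u
    have hψk : ∀ k : ℤ, ∀ z ∈ gr h k, ψ z ∈ gr h k := by
      intro k z hz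
      rw [mem_gr]
      conv_lhs => rw [← hψ.1.map_h, ← LieEquiv.map_lie, mem_gr.1 hz, map_smul]
    have hneg : negCoord deg (t.equivFun (ψ X)) = c := negCoord_eq_of_part_eq hG (by
      rw [← hψ.1.map_f, ← hX]
      exact part_map hG (ψ : g →ₗ⁅ℝ⁆ g) hψk X)
    have h1 := hp (t.equivFun (ψ X)) (by rwa [hneg])
    rw [hΦψ _ (by rwa [hneg]) ψ (by rwa [hneg]), total_equivFun, LieEquiv.symm_apply_apply, nonnegCoord_total_constrPt] at h1
    rw [h1]
    simp
  · intro p q r hr x hx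
    obtain ⟨ψ, hψ⟩ := hFψ _ hx
    have hX := hψ.1.part_symm hG (x := x) rfl
    have hpt : constrPt t deg f (nonnegCoord t deg (ψ.symm (total t x))) =
        t.equivFun (ψ.symm (total t x)) := by
      rw [← LinearEquiv.symm_apply_eq, ← total_eq, total_constrPt_nonnegCoord hG hX]
    rw [hΦψ x hx ψ hψ r, hr, eval_constrBracket, hpt]
    exact hG.poisson_eq_of_conj ψ hψ.1.map_form (hΦs p x hx) (hΦs q x hx)
      (differentiable_eval_nonneg p.1 _) (differentiable_eval_nonneg q.1 _)
      (fun z hz => hΦψ z (by rwa [hz]) ψ (by rwa [hz]) p)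
      (fun z hz => hΦψ z (by rwa [hz]) ψ (by rwa [hz]) q) (hΦinv p x hx) (hΦinv q x hx)

end SliceData

end Enlarged

end FiniteW

/-! ### Assembly of the main theorem. -/

theorem mainTheorem3
    {g : Type*} [LieRing g] [LieAlgebra ℝ g] [LieAlgebra.IsSimple ℝ g]
    {R : Type*} [AddCommGroup R] [Module ℝ R] [FiniteDimensional ℝ R]
    [LieRingModule g R] [LieModule ℝ g R]
    (hR : (LieModule.traceForm ℝ g R).Nondegenerate)
    {h e f : g} (htriple : IsSl2Triple h e f)
    {ι : Type*} [Fintype ι] [DecidableEq ι]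
    (t : Module.Basis ι ℝ g) (deg : ι → ℤ)
    (hdeg : ∀ a, ⁅h, t a⁆ = (2 * (deg a : ℝ)) • t a)
    (habel : ∀ x ∈ FiniteW.gPlus t deg, ∀ y ∈ FiniteW.gPlus t deg, ⁅x, y⁆ = 0)
    {κ : Type*} [Fintype κ] [DecidableEq κ] (σ : κ → ℤ)
    (ℓ : κ → g) (hℓ : FiniteW.IsHighestWeightBasis h e σ ℓ)
    (V : Set (FiniteW.NegIdx deg → ℝ)) (hVopen : IsOpen V)
    (hV : V ⊆ FiniteW.regularSet (LieModule.traceForm ℝ g R) t deg h f)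
    (ℓt : κ → (FiniteW.NegIdx deg → ℝ) → g)
    (hℓt : FiniteW.IsHighestWeightFrame t deg h σ V ℓt) :
    -- over `V` the highest weight form is reached by a unique element of `G_+`
    (∀ x, FiniteW.negCoord deg x ∈ V →
      ∃! p : FiniteW.gPlus t deg × (κ → ℝ),
        FiniteW.IsHighestWeightForm t deg ℓt x (p.1 : g) p.2) ∧
    -- the finite W-algebra is closed under its bracket
    (∀ p q : FiniteW.wAlgebra t deg f,
      FiniteW.constrBracket (LieModule.traceForm ℝ g R) t deg f p q ∈
        FiniteW.wAlgebra t deg f) ∧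
    -- it is generated by the `W_s`
    ∃ W : κ → FiniteW.wAlgebra t deg f,
      FiniteW.IsGaugeGenerators t deg f ℓ W ∧
      Algebra.adjoin ℝ (Set.range W) = ⊤ ∧
      -- the renormalization, for an arbitrary choice of the highest weight vectors
      (∀ c₀ ∈ V, ∃ U : Set (FiniteW.NegIdx deg → ℝ),
        IsOpen U ∧ c₀ ∈ U ∧ U ⊆ V ∧ V ⊆ closure U ∧
        ∃ F : (FiniteW.NegIdx deg → ℝ) → Matrix κ κ ℝ,
          (∀ s r, ContDiffOn ℝ ∞ (fun c => F c s r) U) ∧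
          (∀ c ∈ U, IsUnit (F c)) ∧
          (∀ c ∈ U, ∀ s r, σ s ≠ σ r → F c s r = 0) ∧
          FiniteW.FormWAlgebra (LieModule.traceForm ℝ g R) t deg f U W
            (FiniteW.renormalized t deg ℓt F)) ∧
      -- the renormalization generator by generator, for highest weight vectors proportional to
      -- conjugates of the `ℓ^s`
      (V.Nonempty → ∀ m : κ → (FiniteW.NegIdx deg → ℝ) → ℝ,
        (∀ s, ContDiffOn ℝ ∞ (m s) V) → (∀ s, ∀ c ∈ V, m s c ≠ 0) →
        (∀ c ∈ V, ∃ ψ : g ≃ₗ⁅ℝ⁆ g,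
          FiniteW.IsGradedConj (LieModule.traceForm ℝ g R) t deg h f c ψ ∧
          ∀ s, ψ (ℓ s) = m s c • ℓt s c) →
        FiniteW.FormWAlgebra (LieModule.traceForm ℝ g R) t deg f V W
          (fun s x => (m s (FiniteW.negCoord deg x))⁻¹ * FiniteW.wTilde t deg ℓt s x)) := by
  obtain ⟨he, hf⟩ := FiniteW.triple_mem htriple
  have hG : FiniteW.ShortGrading (LieModule.traceForm ℝ g R) t deg h :=
    FiniteW.shortGrading_of_abelian (LieModule.traceForm_comm ℝ g R)
      (LieModule.traceForm_apply_lie_apply ℝ g R) hR.1 htriple hdeg habel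
  obtain ⟨L, hL, hL'⟩ := hℓ.exists_coord
  obtain ⟨W, hW⟩ := FiniteW.exists_sliceGenerators hG htriple hℓ
  have hS : FiniteW.SliceData (LieModule.traceForm ℝ g R) t deg h e f σ ℓ L W :=
    ⟨hG, htriple, hℓ, hL, hL', hW⟩
  refine ⟨fun x hx => ?_, FiniteW.constrBracket_mem hG hf, W, hW.isGaugeGenerators hG htriple,
    hW.adjoin_eq_top hG htriple, fun c₀ hc₀ => ?_, fun hne m hm hm0 hψ => ?_⟩
  · obtain ⟨e', ht', hb⟩ := hℓt.basis _ hx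
    exact hG.existsUnique_highestWeightForm ht' hb
  · obtain ⟨U, hU, hcU, hUV, hVU, F, hF⟩ := FiniteW.exists_dense_glue_mem (Y := Matrix κ κ ℝ)
      -- The glued property asks for smoothness of the matrix only; `ψ` is chosen pointwise.
      (Q := fun F c => (∀ s r, ContDiffAt ℝ ∞ (fun c => F c s r) c) ∧ ∃ ψ : g ≃ₗ⁅ℝ⁆ g,
        FiniteW.IsConjFrame (LieModule.traceForm ℝ g R) t deg h f L ℓt c ψ (F c))
      (fun F F' c hFF' hF => ⟨fun s r => (hF.1 s r).congr_of_eventuallyEq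
        (hFF'.mono fun c' hc' => by simp only [hc']), by rw [hFF'.eq_of_nhds]; exact hF.2⟩)
      hVopen (fun c hc => by
        obtain ⟨N, T, hN, hcN, hT, hNψ⟩ :=
          FiniteW.exists_smooth_gradedConj hG htriple (hV hc)
        refine ⟨N ∩ V, hN.inter hVopen, ⟨hcN, hc⟩, fun c => Matrix.of fun s r =>
          L (t.equivFun.symm (T c (t.equivFun (ℓt r c)))) s, fun c' hc' => ⟨fun s r =>
          FiniteW.contDiffAt_frame hℓt hVopen hN hT hc'.1 hc'.2 L s r, ?_⟩⟩
        obtain ⟨ψ, hψ, hTψ⟩ := hNψ c' hc'.1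
        exact ⟨ψ, FiniteW.isConjFrame_of_eq hψ hTψ L⟩) hc₀
    refine ⟨U, hU, hcU, hUV, hVU, F, fun s r c hc => ((hF c hc).1 s r).contDiffWithinAt,
      fun c hc => ?_, fun c hc s r hsr => ?_, ?_⟩
    · obtain ⟨ψ, hψ⟩ := (hF c hc).2
      exact hS.isUnit_frame hℓt (hUV hc) hψ
    · obtain ⟨ψ, hψ⟩ := (hF c hc).2
      exact hS.frame_eq_zero hℓt (hUV hc) hψ hsr
    · exact hS.formWAlgebra hVopen hV hℓt hU hUV ⟨c₀, hcU⟩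
        (fun s r c hc => ((hF c hc).1 s r).contDiffWithinAt) fun c hc => (hF c hc).2
  -- From `ψ ℓ^s = m_s ℓ̃^s` follows `ψ⁻¹ ℓ̃^s = m_s⁻¹ ℓ^s`: the frame matrix is diagonal and
  -- globally smooth, so no gluing is needed.
  · have heq : (fun s x => (m s (FiniteW.negCoord deg x))⁻¹ * FiniteW.wTilde t deg ℓt s x) =
        FiniteW.renormalized t deg ℓt fun c => Matrix.diagonal fun s => (m s c)⁻¹ := by
      funext s x
      simp [FiniteW.renormalized, Matrix.diagonal_apply]
    rw [heq]
    refine hS.formWAlgebra hVopen hV hℓt hVopen subset_rfl hne (fun s r => ?_) fun c hc => ?_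
    · simp only [Matrix.diagonal_apply]
      split_ifs
      · exact (hm s).inv (hm0 s)
      · exact contDiffOn_const
    · obtain ⟨ψ, hconj, hψℓ⟩ := hψ c hc
      refine ⟨ψ, hconj, fun s r => ?_⟩
      have h1 : ψ.symm (ℓt r c) = (m r c)⁻¹ • ℓ r := by
        rw [← LieEquiv.symm_apply_apply ψ (ℓ r), hψℓ, map_smul, smul_smul,
          inv_mul_cancel₀ (hm0 r c hc), one_smul]
      have h2 : L (ℓ r) = Pi.single r 1 := by
        rw [← hL (Pi.single r 1)]
        simp [Pi.single_apply]
      rw [h1, map_smul, h2, Matrix.diagonal_apply, Pi.smul_apply, Pi.single_apply, smul_eq_mul]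
      split_ifs with hsr
      · rw [hsr, mul_one]
      · rw [mul_zero]
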